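/- Let $\Omega=\{1,2\}^{\mathbb Z}$ with the product topology and the coordinatewise order. Let $\Omega_f\subset\Omega$ be the set of configurations with finitely many 2's and $\Omega_1\subset\Omega$ the set of configurations with infinitely many 1's on each side of the origin. For $\eta\in\Omega$ and $i\in\mathbb Z$ put $k^+=\inf\{j\ge 0:\eta(i+j)=1\}$ and $k^-=\inf\{j>0:\eta(i-j)=1\}$, with $\inf\emptyset=+\infty$. Writing $e_x$ for the indicator function of the site $x$, define the toppling map $T_i$ as follows: $T_i\eta=\eta+e_i$ if $\eta(i)=1$; if $\eta(i)=2$, then $T_i\eta=\eta+e_{i+k^+}+e_{i-k^-}-e_{i+k^+-k^-}$ when $k^+,k^-<\infty$, $T_i\eta=\eta+e_{i-k^-}$ when only $k^-<\infty$, $T_i\eta=\eta+e_{i+k^+}$ when only $k^+<\infty$, and $T_i\eta=\eta$ when $k^+=k^-=\infty$. The formal generator is $$Lf(\eta)=\sum_{i\in\mathbb Z}\,[f(T_i\eta)-f(\eta)].$$ For $n\in\mathbb N$ let $S_n(t)$ be the semigroup of the continuous-time Markov chain on $\Omega_f$ with generator $L_nf(\eta)=\sum_{i:\ \eta(i)=2\text{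 or }|i|\le n}[f(T_i\eta)-f(\eta)]$. We say that $f$ has *iterated limit* $v$ at $(t,\eta)$ if, for every $n$, the limit $w_n$ of $S_n(t)f(\eta'_m)$ as $m\to\infty$ exists and is the same for all increasing sequences $(\eta'_m)$ in $\Omega_f$ converging to $\eta$, and $w_n\to v$ as $n\to\infty$. The law $P_t^\eta$ at time $t$ of the sandpile process started from $\eta$ is the probability measure on $\Omega$ such that every function $g$ depending on finitely many coordinates has iterated limit $\int g\,dP_t^\eta$ at $(t,\eta)$. The semigroup is $S(t)f(\eta)=\int f\,dP_t^\eta$. For $\eta\in\Omega_1$ let $\cdots<X_{-1}<0\le X_0<X_1<\cdots$ be the sites with $\eta=1$, and let $I_j(\eta)=(X_{j-1},X_j]\cap\mathbb Z$. A function $f:\Omega_1\to\mathbb R$ is *$N$-local* if $f(\eta)$ is a function of the restriction of $\eta$ to $\bigcup_{j=-N}^{N}I_j(\eta)$. The configuration $\eta$ is *decent* if $\eta\in\Omega_1$ and $$a(\eta)=\limsup_{n\to\infty}\frac{|I_{-n}(\eta)|+\dots+|I_n(\eta)|}{2n}<\infty .$$ **Theorem 4.1.** Let $f:\Omega_1\to\mathbb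 R$ be bounded and $N$-local for some $N\in\mathbb N$, and let $\eta$ be decent. For all $n\ge0$ and $\xi\in\Omega_1$, the series defining $L^{n+1}f(\xi)=L(L^nf)(\xi)$ converges absolutely. For every $0\le t<\frac1{4e\,a(\eta)}$, the law $P_t^\eta$ exists and is carried by $\Omega_1$, $f$ is $P_t^\eta$-integrable, the series $\sum_{n\ge0}\frac{t^nL^nf(\eta)}{n!}$ converges absolutely, and $$\sum_{n=0}^\infty\frac{t^n}{n!}L^nf(\eta)=S(t)f(\eta);$$ moreover $S(t)f(\eta)$ is the iterated limit of $f$ at $(t,\eta)$. In particular, $$\lim_{t\downarrow0}\frac{S(t)f(\eta)-f(\eta)}{t}=Lf(\eta).$$ -/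

import Mathlib

open Filter Topology MeasureTheory
open scoped ENNReal Nat

noncomputable section

namespace Sandpile

/-- Configurations of heights in `{1, 2}` on the integers, with the product topology, product
sigma-algebra and coordinatewise order. The value `false` stands for height 1 and the value
`true` for height 2 (a critical site), so that `false < true` matches `1 < 2`. -/
abbrev Config : Type := ℤ → Bool

/-- The configurations with finitely many critical sites. -/
def finiteConfigs : Set Config := {η | {x : ℤ | η x = true}.Finite}

/-- The configurations with infinitely many 1s on both sides of the origin. -/
def twoSided : Set Config :=
  {η | {x : ℤ | x < 0 ∧ η x = false}.Infinite ∧ {x : ℤ | 0 < x ∧ η x = false}.Infinite}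

/-! ### The toppling transformation -/

/-- Distances `j ≥ 0` from `i` to the 1s at or to the right of `i`. -/
def rightDist (i : ℤ) (η : Config) : Set ℕ := {j | η (i + j) = false}

/-- Distances `j > 0` from `i` to the 1s strictly to the left of `i`. -/
def leftDist (i : ℤ) (η : Config) : Set ℕ := {j | 0 < j ∧ η (i - j) = false}

/-- Distance from `i` to the first 1 at or to the right of `i` (used only when there is one). -/
def kPlus (i : ℤ) (η : Config) : ℕ := sInf (rightDist i η)

/-- Distance from `i` to the first 1 strictly to the left of `i` (used only when there is one). -/
def kMinus (i : ℤ) (η : Config) : ℕ := sInf (leftDist i η)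

open Classical in
/-- The configuration after one particle has been added at `i` and the avalanche has ended. The
last three cases are the conventions for an infinite distance on one side or on both. -/
def topple (i : ℤ) (η : Config) : Config :=
  if η i = false then Function.update η i true
  else if (rightDist i η).Nonempty ∧ (leftDist i η).Nonempty then
    Function.update
      (Function.update (Function.update η (i + kPlus i η) true) (i - kMinus i η) true)
      (i + kPlus i η - kMinus i η) false
  else if (leftDist i η).Nonempty then Function.update η (i - kMinus i η) true
  else if (rightDist i η).Nonempty then Function.update η (i + kPlus i η) true
  else η

/-- The formal generator `L f (η) = ∑ i, (f (T_i η) - f η)`. -/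
def generator (f : Config → ℝ) (η : Config) : ℝ := ∑' i : ℤ, (f (topple i η) - f η)

/-! ### Intervals between consecutive ones, `N`-local functions, decent configurations -/

/-- The increasing enumeration `X_j` of the 1s of a configuration in `twoSided`: `X_0` is the
first 1 in `{0, 1, 2, …}`, `X_1` the next one, and `X_{-1}` is the last 1 in `{…, -2, -1}`. -/
def onePos (η : Config) : ℤ → ℤ
  | Int.ofNat k => (Nat.nth (fun m : ℕ => η (m : ℤ) = false) k : ℤ)
  | Int.negSucc k => -1 - (Nat.nth (fun m : ℕ => η (-1 - (m : ℤ)) = false) k : ℤ)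

/-- The interval `I_j = (X_{j-1}, X_j]`. -/
def gap (η : Config) (j : ℤ) : Finset ℤ := Finset.Ioc (onePos η (j - 1)) (onePos η j)

/-- The union of the intervals `I_{-N}, …, I_N`. -/
def window (N : ℕ) (η : Config) : Finset ℤ :=
  (Finset.Icc (-(N : ℤ)) (N : ℤ)).biUnion (gap η)

/-- `f`, as a function on `twoSided`, is `N`-local around the origin: `f η` is a function of the
restriction of `η` to the random window `I_{-N} ∪ … ∪ I_N`. No condition is put on the values of
`f` outside `twoSided`. -/
def NLocal (N : ℕ) (f : Config → ℝ) : Prop :=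
  ∀ η ∈ twoSided, ∀ ξ ∈ twoSided, window N η = window N ξ →
    (∀ x ∈ window N η, η x = ξ x) → f η = f ξ

/-- The asymptotic mean gap `a(η) = limsup_n (|I_{-n}| + … + |I_n|) / (2 n)`. -/
def meanGap (η : Config) : ℝ≥0∞ :=
  limsup (fun n : ℕ =>
    (∑ j ∈ Finset.Icc (-(n : ℤ)) (n : ℤ), ((gap η j).card : ℝ≥0∞)) / (2 * (n : ℝ≥0∞))) atTop

/-- The decent configurations. -/
def decent : Set Config := {η | η ∈ twoSided ∧ meanGap η < ∞}

/-! ### The approximating Markov chains on `finiteConfigs` -/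

/-- The sites where a particle is added at rate one in the `n`-th chain: the critical sites
(avalanches) and the sites of `[-n, n]` (births, if the height is 1). -/
def activeSites (n : ℕ) (η : Config) : Set ℤ :=
  {i | η i = true ∨ (-(n : ℤ) ≤ i ∧ i ≤ (n : ℤ))}

/-- Total jump rate of the `n`-th chain at `η` in `finiteConfigs`. -/
def jumpRate (n : ℕ) (η : Config) : ℝ := ((activeSites n η).ncard : ℝ)

open Classical in
/-- The probability that the `n`-th chain (the continuous-time jump chain with generator
`L_n f (η) = ∑ i ∈ activeSites n η, (f (T_i η) - f η)`) goes from `η` to `ζ` in time `t` with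
fewer than `m` jumps, by conditioning on the first jump. -/
def transIter (n : ℕ) : ℕ → ℝ → Config → Config → ℝ≥0∞
  | 0, _, _, _ => 0
  | m + 1, t, η, ζ =>
      ENNReal.ofReal (Real.exp (-(jumpRate n η * t))) * (if η = ζ then 1 else 0) +
      ∫⁻ s in Set.Ioc 0 t, ENNReal.ofReal (Real.exp (-(jumpRate n η * s))) *
        ∑' i : activeSites n η, transIter n m (t - s) (topple i η) ζ

/-- The transition function of the `n`-th chain (minimal solution of the Kolmogorov backward
equation, by Feller's construction). -/
def transProb (n : ℕ) (t : ℝ) (η ζ : Config) : ℝ≥0∞ := ⨆ m, transIter n m t η ζ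

/-- The semigroup `S_n(t)` of the `n`-th chain, at `η` in `finiteConfigs`. -/
def chainSemigroup (n : ℕ) (t : ℝ) (f : Config → ℝ) (η : Config) : ℝ :=
  ∑' ζ : finiteConfigs, (transProb n t η ζ).toReal * f ζ

/-! ### The infinite volume process -/

/-- The iterated limit, first along increasing sequences in `finiteConfigs` with limit `η`
(for every such sequence, with the same result) and then as `n → ∞`, of `S_n(t) f` exists and
is `v`. -/
def HasIteratedLimit (t : ℝ) (f : Config → ℝ) (η : Config) (v : ℝ) : Prop :=
  ∃ w : ℕ → ℝ,
    (∀ n : ℕ, ∀ ξ : ℕ → Config, (∀ m, ξ m ∈ finiteConfigs) → Monotone ξ →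
      Tendsto ξ atTop (𝓝 η) → Tendsto (fun m => chainSemigroup n t f (ξ m)) atTop (𝓝 (w n))) ∧
    Tendsto w atTop (𝓝 v)

/-- `P` is the law at time `t` of the sandpile process started from `η`: the expectation of each
local function is the iterated limit. There is at most one such `P`, since the local functions
determine a probability measure on `Config`. -/
def IsSandpileLaw (t : ℝ) (η : Config) (P : Measure Config) : Prop :=
  IsProbabilityMeasure P ∧
    ∀ (A : Finset ℤ) (g : Config → ℝ), DependsOn g (A : Set ℤ) →
      HasIteratedLimit t g η (∫ ζ, g ζ ∂P)

open Classical in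
/-- The law at time `t` of the sandpile process started from `η`. -/
def sandpileLaw (t : ℝ) (η : Config) : Measure Config :=
  if h : ∃ P, IsSandpileLaw t η P then h.choose else 0

/-- The semigroup of the sandpile process, `S(t) f (η) = E^η f(η_t)`. -/
def semigroup (t : ℝ) (f : Config → ℝ) (η : Config) : ℝ := ∫ ζ, f ζ ∂(sandpileLaw t η)

end Sandpile

end

open Filter Topology MeasureTheory
open scoped ENNReal Nat

noncomputable section

namespace Sandpile

/-! ### Counting the ones between the origin and a site -/

/-! A site lies in `window M ξ` exactly when at most `M` ones separate it from the origin
(`mem_window_iff`). A toppling replaces two consecutive ones by a single one between them, so it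
lowers such a count by at most one (`oneCount_le_topple`). Hence the generator sends `N`-local
functions to `(N+1)`-local ones, acts on them by finite sums, and satisfies `|L^k f| ≤ C (2 |window
(N + k)|)^k` (`NLocal.abs_iterate_le`). At a decent configuration the window has at most about `2 (N
+ k) a` sites, and `M^k / k! ≤ e^M` turns the exponential series into a geometric one of ratio `4 e
a t` (`summable_window`).

The estimates hold for any local activity rule, hence for the approximating chains too, uniformly in
`n` and in all configurations below `η`. For a finite configuration the chain's semigroup is the
exponential series when `t < 1/2` (`chainSemigroup_eq_expSeries`): the series solves the backward
equation, and Feller's iterates converge to it because the error halves at each step. Dominated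
convergence then gives both limits (`hasIteratedLimit_expSeries`).

The law exists by compactness of the probability measures on `Config`. An `N`-local `f` is the limit
on `twoSided` of local cutoffs with the same `N`; the series is continuous along them. For `f = 1`
this shows that the law is carried by `twoSided`, and for general `f` that its integral is the
series. -/

lemma mem_twoSided_iff {ξ : Config} :
    ξ ∈ twoSided ↔ (∀ x : ℤ, ∃ a < x, ξ a = false) ∧ ∀ x : ℤ, ∃ b ≥ x, ξ b = false := by
  constructor
  · rintro ⟨h1, h2⟩
    constructor
    · intro x
      by_contra! h
      refine h1 ((Set.finite_Ico x 0).subset ?_)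
      rintro y ⟨hy, hy'⟩
      refine ⟨?_, hy⟩
      by_contra! hlt
      exact h y hlt hy'
    · intro x
      by_contra! h
      refine h2 ((Set.finite_Ioo 0 x).subset ?_)
      rintro y ⟨hy, hy'⟩
      refine ⟨hy, ?_⟩
      by_contra! hlt
      exact h y hlt hy'
  · rintro ⟨h1, h2⟩
    refine ⟨?_, ?_⟩
    · intro hfin
      obtain ⟨m, hm⟩ := hfin.bddBelow
      obtain ⟨a, ha, ha'⟩ := h1 (min m 0)
      have := hm (show a ∈ {x : ℤ | x < 0 ∧ ξ x = false} from ⟨by omega, ha'⟩)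
      omega
    · intro hfin
      obtain ⟨m, hm⟩ := hfin.bddAbove
      obtain ⟨a, ha, ha'⟩ := h2 (max m 0 + 1)
      have := hm (show a ∈ {x : ℤ | 0 < x ∧ ξ x = false} from ⟨by omega, ha'⟩)
      omega

lemma finiteConfigs_subset_twoSided : finiteConfigs ⊆ twoSided := by
  intro ξ hξ
  have hξ' : {x : ℤ | ξ x = true}.Finite := hξ
  rw [mem_twoSided_iff]
  constructor
  · intro x
    obtain ⟨m, hm⟩ := hξ'.bddBelow
    refine ⟨min m x - 1, by omega, ?_⟩
    by_contra h
    have := hm (show min m x - 1 ∈ {x : ℤ | ξ x = true} by simpa using h)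
    omega
  · intro x
    obtain ⟨m, hm⟩ := hξ'.bddAbove
    refine ⟨max m x + 1, by omega, ?_⟩
    by_contra h
    have := hm (show max m x + 1 ∈ {x : ℤ | ξ x = true} by simpa using h)
    omega

/-- The number of 1s in `[0, x)` or in `[x, 0)`. -/
def oneCount (ξ : Config) (x : ℤ) : ℕ :=
  ((Finset.Ico (min 0 x) (max 0 x)).filter (fun y => ξ y = false)).card

lemma oneCount_congr {ξ ξ' : Config} {x : ℤ}
    (h : ∀ y, min 0 x ≤ y → y < max 0 x → ξ y = ξ' y) : oneCount ξ x = oneCount ξ' x := by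
  unfold oneCount
  congr 1
  refine Finset.filter_congr fun y hy => ?_
  rw [Finset.mem_Ico] at hy
  rw [h y hy.1 hy.2]

lemma oneCount_anti {ξ η : Config} (h : ξ ≤ η) (x : ℤ) : oneCount η x ≤ oneCount ξ x := by
  refine Finset.card_le_card fun y hy => ?_
  rw [Finset.mem_filter] at hy ⊢
  refine ⟨hy.1, ?_⟩
  have := h y
  rw [hy.2] at this
  exact le_bot_iff.1 this

lemma oneCount_mono_right (ξ : Config) {x y : ℤ} (hx : 0 ≤ x) (hxy : x ≤ y) :
    oneCount ξ x ≤ oneCount ξ y := by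
  refine Finset.card_le_card (Finset.filter_subset_filter _ (Finset.Ico_subset_Ico ?_ ?_)) <;> omega

lemma oneCount_mono_left (ξ : Config) {x y : ℤ} (hx : x ≤ 0) (hxy : y ≤ x) :
    oneCount ξ x ≤ oneCount ξ y := by
  refine Finset.card_le_card (Finset.filter_subset_filter _ (Finset.Ico_subset_Ico ?_ ?_)) <;> omega

lemma oneCount_add_one_le (ξ : Config) {x : ℤ} (hx : 0 ≤ x) :
    oneCount ξ (x + 1) ≤ oneCount ξ x + 1 := by
  unfold oneCount
  refine le_trans (Finset.card_le_card ?_) (Finset.card_insert_le x _)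
  intro y hy
  simp only [Finset.mem_insert, Finset.mem_filter, Finset.mem_Ico] at hy ⊢
  by_cases hyx : y = x
  · exact Or.inl hyx
  · exact Or.inr ⟨by omega, hy.2⟩

lemma oneCount_le_natAbs (ξ : Config) (x : ℤ) : oneCount ξ x ≤ x.natAbs := by
  refine (Finset.card_filter_le _ _).trans ?_
  rw [Int.card_Ico]
  omega

lemma oneCount_natCast (ξ : Config) (k : ℕ) :
    oneCount ξ k = Nat.count (fun m : ℕ => ξ (m : ℤ) = false) k := by
  rw [Nat.count_eq_card_filter_range]
  refine Finset.card_nbij' Int.toNat (fun m => (m : ℤ)) ?_ ?_ ?_ ?_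
  · intro y hy
    simp only [Finset.coe_filter, Finset.mem_Ico, Finset.mem_range, Set.mem_ofPred_eq] at hy ⊢
    rw [Int.toNat_of_nonneg (by omega)]
    exact ⟨by omega, hy.2⟩
  · intro y hy
    simp only [Finset.coe_filter, Finset.mem_Ico, Finset.mem_range, Set.mem_ofPred_eq] at hy ⊢
    exact ⟨by omega, hy.2⟩
  · intro y hy
    simp only [Finset.coe_filter, Finset.mem_Ico, Set.mem_ofPred_eq] at hy
    exact Int.toNat_of_nonneg (by omega)
  · intro y _
    simp

lemma oneCount_neg_natCast (ξ : Config) (k : ℕ) :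
    oneCount ξ (-(k : ℤ)) = Nat.count (fun m : ℕ => ξ (-1 - (m : ℤ)) = false) k := by
  rw [Nat.count_eq_card_filter_range]
  refine Finset.card_nbij' (fun y => (-1 - y).toNat) (fun m => -1 - (m : ℤ)) ?_ ?_ ?_ ?_
  · intro y hy
    simp only [Finset.coe_filter, Finset.mem_Ico, Finset.mem_range, Set.mem_ofPred_eq] at hy ⊢
    rw [Int.toNat_of_nonneg (by omega), show -1 - (-1 - y) = y by ring]
    exact ⟨by omega, hy.2⟩
  · intro y hy
    simp only [Finset.coe_filter, Finset.mem_Ico, Finset.mem_range, Set.mem_ofPred_eq] at hy ⊢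
    exact ⟨by omega, hy.2⟩
  · intro y hy
    simp only [Finset.coe_filter, Finset.mem_Ico, Set.mem_ofPred_eq] at hy
    show -1 - ((-1 - y).toNat : ℤ) = y
    omega
  · intro y _
    simp

lemma onePos_natCast (ξ : Config) (k : ℕ) :
    onePos ξ k = (Nat.nth (fun m : ℕ => ξ (m : ℤ) = false) k : ℤ) := rfl

lemma onePos_neg_natCast_sub_one (ξ : Config) (k : ℕ) :
    onePos ξ (-(k : ℤ) - 1) = -1 - (Nat.nth (fun m : ℕ => ξ (-1 - (m : ℤ)) = false) k : ℤ) := by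
  rw [show -(k : ℤ) - 1 = Int.negSucc k by rw [Int.negSucc_eq]; ring]
  rfl

lemma onePos_neg_lt_zero (ξ : Config) (k : ℕ) : onePos ξ (-(k : ℤ) - 1) < 0 := by
  rw [onePos_neg_natCast_sub_one]
  omega

lemma onePos_natCast_nonneg (ξ : Config) (k : ℕ) : 0 ≤ onePos ξ k := by
  rw [onePos_natCast]
  omega

lemma card_window_le (ξ : Config) (M : ℕ) :
    (window M ξ).card ≤ ∑ j ∈ Finset.Icc (-(M : ℤ)) (M : ℤ), (gap ξ j).card :=
  Finset.card_biUnion_le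

section TwoSided

variable {ξ : Config} (hξ : ξ ∈ twoSided)
include hξ

lemma infinite_right : (Set.ofPred fun m : ℕ => ξ (m : ℤ) = false).Infinite := by
  refine Set.infinite_of_forall_exists_gt fun n => ?_
  obtain ⟨b, hb, hb'⟩ := (mem_twoSided_iff.1 hξ).2 (n + 1)
  refine ⟨b.toNat, ?_, by omega⟩
  show ξ (b.toNat : ℤ) = false
  rwa [Int.toNat_of_nonneg (by omega)]

lemma infinite_left : (Set.ofPred fun m : ℕ => ξ (-1 - (m : ℤ)) = false).Infinite := by
  refine Set.infinite_of_forall_exists_gt fun n => ?_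
  obtain ⟨b, hb, hb'⟩ := (mem_twoSided_iff.1 hξ).1 (-1 - n)
  refine ⟨(-1 - b).toNat, ?_, by omega⟩
  show ξ (-1 - ((-1 - b).toNat : ℤ)) = false
  rwa [Int.toNat_of_nonneg (by omega), show -1 - (-1 - b) = b by ring]

lemma apply_onePos_natCast (k : ℕ) : ξ (onePos ξ k) = false := by
  rw [onePos_natCast]
  exact Nat.nth_mem_of_infinite (infinite_right hξ) k

lemma apply_onePos_neg (k : ℕ) : ξ (onePos ξ (-(k : ℤ) - 1)) = false := by
  rw [onePos_neg_natCast_sub_one]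
  exact Nat.nth_mem_of_infinite (infinite_left hξ) k

/-- Counting and enumerating the ones are adjoint, on each half-line separately. -/
lemma oneCount_le_iff (M : ℕ) (x : ℤ) :
    oneCount ξ x ≤ M ↔ onePos ξ (-(M : ℤ) - 1) < x ∧ x ≤ onePos ξ M := by
  rw [onePos_natCast, onePos_neg_natCast_sub_one]
  rcases le_total 0 x with hx | hx
  · lift x to ℕ using hx
    rw [oneCount_natCast, Nat.count_le_iff_le_nth (infinite_right hξ)]
    omega
  · obtain ⟨y, rfl⟩ : ∃ y : ℕ, x = -(y : ℤ) := ⟨x.natAbs, by omega⟩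
    rw [oneCount_neg_natCast, Nat.count_le_iff_le_nth (infinite_left hξ)]
    omega

lemma onePos_mono_right (k : ℕ) : onePos ξ k ≤ onePos ξ (k + 1 : ℕ) := by
  rw [onePos_natCast, onePos_natCast]
  exact_mod_cast Nat.nth_monotone (infinite_right hξ) (Nat.le_succ k)

lemma onePos_mono_left (k : ℕ) :
    onePos ξ (-((k + 1 : ℕ) : ℤ) - 1) ≤ onePos ξ (-(k : ℤ) - 1) := by
  rw [onePos_neg_natCast_sub_one, onePos_neg_natCast_sub_one]
  have := Nat.nth_monotone (infinite_left hξ) (Nat.le_succ k)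
  have h : (Nat.nth (fun m : ℕ => ξ (-1 - (m : ℤ)) = false) k : ℤ) ≤
    Nat.nth (fun m : ℕ => ξ (-1 - (m : ℤ)) = false) (k + 1) := by exact_mod_cast this
  linarith

lemma mem_window_iff (M : ℕ) (x : ℤ) : x ∈ window M ξ ↔ oneCount ξ x ≤ M := by
  rw [oneCount_le_iff hξ]
  induction M with
  | zero => simp [window, gap]
  | succ M ih =>
    have h1 := onePos_mono_right hξ M
    have h2 := onePos_mono_left hξ M
    have key : x ∈ window (M + 1) ξ ↔
        x ∈ gap ξ (-((M + 1 : ℕ) : ℤ)) ∨ x ∈ window M ξ ∨ x ∈ gap ξ ((M + 1 : ℕ) : ℤ) := by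
      simp only [window, Finset.mem_biUnion, Finset.mem_Icc]
      constructor
      · rintro ⟨j, hj, hx⟩
        by_cases h : j = -((M + 1 : ℕ) : ℤ)
        · exact Or.inl (h ▸ hx)
        by_cases h' : j = ((M + 1 : ℕ) : ℤ)
        · exact Or.inr (Or.inr (h' ▸ hx))
        exact Or.inr (Or.inl ⟨j, by omega, hx⟩)
      · rintro (h | ⟨j, hj, hx⟩ | h)
        · exact ⟨_, by omega, h⟩
        · exact ⟨j, by omega, hx⟩
        · exact ⟨_, by omega, h⟩
    rw [key, ih, gap, gap, Finset.mem_Ioc, Finset.mem_Ioc,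
      show -((M + 1 : ℕ) : ℤ) = -(M : ℤ) - 1 by push_cast; ring,
      show ((M + 1 : ℕ) : ℤ) - 1 = M by push_cast; ring]
    rw [show -((M + 1 : ℕ) : ℤ) - 1 = -(M : ℤ) - 1 - 1 by push_cast; ring] at h2
    have h0 : onePos ξ (-(M : ℤ) - 1) < onePos ξ M := by
      rw [onePos_natCast, onePos_neg_natCast_sub_one]
      omega
    omega

lemma window_mono {M M' : ℕ} (h : M ≤ M') : window M ξ ⊆ window M' ξ := by
  intro x hx
  rw [mem_window_iff hξ] at hx ⊢
  omega

lemma le_card_window (M : ℕ) : 2 * M + 1 ≤ (window M ξ).card := by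
  have h : Finset.Icc (-(M : ℤ)) M ⊆ window M ξ := by
    intro x hx
    rw [Finset.mem_Icc] at hx
    rw [mem_window_iff hξ]
    have := oneCount_le_natAbs ξ x
    omega
  have := Finset.card_le_card h
  rw [Int.card_Icc] at this
  omega

/-- Toppling at `i` replaces the two 1s around `i` by one at the reflected place. -/
lemma exists_topple_eq (i : ℤ) : ∃ a b : ℤ, a < i ∧ i ≤ b ∧ ξ a = false ∧ ξ b = false ∧
    (∀ x, a < x → x < b → ξ x = true) ∧
    topple i ξ = Function.update (Function.update (Function.update ξ b true) a true)
      (a + b - i) false := by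
  obtain ⟨h1, h2⟩ := mem_twoSided_iff.1 hξ
  have hr : (rightDist i ξ).Nonempty := by
    obtain ⟨b, hb, hb'⟩ := h2 i
    refine ⟨(b - i).toNat, ?_⟩
    show ξ (i + ((b - i).toNat : ℤ)) = false
    rwa [Int.toNat_of_nonneg (by omega), add_sub_cancel]
  have hl : (leftDist i ξ).Nonempty := by
    obtain ⟨b, hb, hb'⟩ := h1 i
    refine ⟨(i - b).toNat, by omega, ?_⟩
    rwa [Int.toNat_of_nonneg (by omega), sub_sub_cancel]
  have hp : ξ (i + kPlus i ξ) = false := Nat.sInf_mem hr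
  have hm : 0 < kMinus i ξ ∧ ξ (i - kMinus i ξ) = false := Nat.sInf_mem hl
  have hp' : ∀ j : ℕ, j < kPlus i ξ → ξ (i + j) = true := fun j hj => by
    simpa [rightDist] using Nat.notMem_of_lt_sInf hj
  have hm' : ∀ j : ℕ, 0 < j → j < kMinus i ξ → ξ (i - j) = true := fun j hj0 hj => by
    simpa [leftDist, hj0] using Nat.notMem_of_lt_sInf hj
  refine ⟨i - kMinus i ξ, i + kPlus i ξ, by omega, by omega, hm.2, hp, ?_, ?_⟩
  · intro x hx hx'
    rcases le_or_gt i x with hix | hix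
    · have := hp' (x - i).toNat (by omega)
      rwa [Int.toNat_of_nonneg (by omega), add_sub_cancel] at this
    · have := hm' (i - x).toNat (by omega) (by omega)
      rwa [Int.toNat_of_nonneg (by omega), sub_sub_cancel] at this
  · unfold topple
    split_ifs with h
    -- If `i` carries a 1 then `b = i`, the reflected place is `a` itself, and the last update
    -- undoes the middle one.
    · have h0 : kPlus i ξ = 0 := by
        refine Nat.sInf_eq_zero.2 (Or.inl ?_)
        simpa [rightDist] using h
      rw [h0]
      have e : (i - (kMinus i ξ : ℤ) + (i + ((0 : ℕ) : ℤ)) - i) = i - kMinus i ξ := by simp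
      rw [e, Function.update_idem]
      have hne : (i - (kMinus i ξ : ℤ)) ≠ i := by omega
      funext x
      by_cases hx : x = i - kMinus i ξ
      · subst hx
        simp [hne, hm.2]
      · simp [hx, Function.update_apply]
    · congr 1
      ring
    · simp_all

lemma topple_mem_twoSided (i : ℤ) : topple i ξ ∈ twoSided := by
  obtain ⟨a, b, hai, hib, -, -, -, h⟩ := exists_topple_eq hξ i
  obtain ⟨h1, h2⟩ := mem_twoSided_iff.1 hξ
  rw [mem_twoSided_iff]
  constructor
  · intro x
    obtain ⟨y, hy, hy'⟩ := h1 (min x a)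
    refine ⟨y, by omega, ?_⟩
    rw [h, Function.update_of_ne (by omega), Function.update_of_ne (by omega),
      Function.update_of_ne (by omega), hy']
  · intro x
    obtain ⟨y, hy, hy'⟩ := h2 (max x (b + 1))
    refine ⟨y, by omega, ?_⟩
    rw [h, Function.update_of_ne (by omega), Function.update_of_ne (by omega),
      Function.update_of_ne (by omega), hy']

/-- Only `a` and `b` can stop being ones. If the interval of counting contains both, it also
contains the reflected place `a + b - i`, which compensates for one of them. -/
lemma oneCount_le_topple (i x : ℤ) : oneCount ξ x ≤ oneCount (topple i ξ) x + 1 := by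
  obtain ⟨a, b, hai, hib, -, -, hbt, h⟩ := exists_topple_eq hξ i
  have hT : ∀ y, y ≠ a → y ≠ b → ξ y = false → topple i ξ y = false := by
    intro y hya hyb hy
    rw [h]
    simp only [Function.update_apply]
    split_ifs <;> trivial
  unfold oneCount
  set J := Finset.Ico (min 0 x) (max 0 x) with hJ
  by_cases hb : b ∈ J
  · by_cases ha : a ∈ J
    · have hc : a + b - i ∈ J := by
        rw [hJ, Finset.mem_Ico] at *
        omega
      have hcF : a + b - i ∈ J.filter (fun y => topple i ξ y = false) := by
        rw [Finset.mem_filter, h]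
        exact ⟨hc, by simp⟩
      have hsub : J.filter (fun y => ξ y = false) ⊆
          insert a (insert b ((J.filter (fun y => topple i ξ y = false)).erase (a + b - i))) := by
        intro y hy
        rw [Finset.mem_filter] at hy
        simp only [Finset.mem_insert, Finset.mem_erase, Finset.mem_filter]
        by_cases hya : y = a
        · exact Or.inl hya
        by_cases hyb : y = b
        · exact Or.inr (Or.inl hyb)
        refine Or.inr (Or.inr ⟨?_, hy.1, hT y hya hyb hy.2⟩)
        rintro rfl
        have := hbt (a + b - i) (by omega) (by omega)
        simp [hy.2] at this
      have h1 := Finset.card_le_card hsub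
      have h2 := Finset.card_insert_le a
        (insert b ((J.filter (fun y => topple i ξ y = false)).erase (a + b - i)))
      have h3 := Finset.card_insert_le b
        ((J.filter (fun y => topple i ξ y = false)).erase (a + b - i))
      have h4 := Finset.card_erase_add_one hcF
      omega
    · refine (Finset.card_le_card ?_).trans (Finset.card_insert_le b _)
      intro y hy
      rw [Finset.mem_filter] at hy
      by_cases hyb : y = b
      · simp [hyb]
      · have hya : y ≠ a := by rintro rfl; exact ha hy.1
        simp [hy.1, hT y hya hyb hy.2]
  · refine (Finset.card_le_card ?_).trans (Finset.card_insert_le a _)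
    intro y hy
    rw [Finset.mem_filter] at hy
    by_cases hya : y = a
    · simp [hya]
    · have hyb : y ≠ b := by rintro rfl; exact hb hy.1
      simp [hy.1, hT y hya hyb hy.2]

end TwoSided

/-! ### Generators with a local activity rule acting on `N`-local functions -/

/-- Topplings of configurations that agree between two 1s agree there. -/
lemma topple_congr {ξ ξ' : Config} (hξ : ξ ∈ twoSided) (hξ' : ξ' ∈ twoSided) {A B i : ℤ}
    (hA : ξ A = false) (hB : ξ B = false) (hAi : A < i) (hiB : i ≤ B)
    (h : ∀ x, A ≤ x → x ≤ B → ξ x = ξ' x) (x : ℤ) (hAx : A ≤ x) (hxB : x ≤ B) :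
    topple i ξ x = topple i ξ' x := by
  obtain ⟨a, b, hai, hib, ha, hb, hab, hT⟩ := exists_topple_eq hξ i
  obtain ⟨a', b', hai', hib', ha', hb', hab', hT'⟩ := exists_topple_eq hξ' i
  have hbtw : ∀ y, ξ y = false → y ≤ a ∨ b ≤ y := by
    intro y hy
    by_contra! hc
    simp [hab y hc.1 hc.2] at hy
  have hbtw' : ∀ y, ξ' y = false → y ≤ a' ∨ b' ≤ y := by
    intro y hy
    by_contra! hc
    simp [hab' y hc.1 hc.2] at hy
  have h1 := hbtw A hA
  have h2 := hbtw B hB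
  have h3 := hbtw' a (by rw [← h a (by omega) (by omega), ha])
  have h4 := hbtw' b (by rw [← h b (by omega) (by omega), hb])
  have h5 := hbtw a' (by rw [h a' (by omega) (by omega), ha'])
  have h6 := hbtw b' (by rw [h b' (by omega) (by omega), hb'])
  obtain rfl : a = a' := by omega
  obtain rfl : b = b' := by omega
  rw [hT, hT']
  simp only [Function.update_apply, h x hAx hxB]

lemma window_congr {ξ ξ' : Config} (hξ : ξ ∈ twoSided) (hξ' : ξ' ∈ twoSided) {M : ℕ}
    (h : ∀ x, oneCount ξ x ≤ M ↔ oneCount ξ' x ≤ M) : window M ξ = window M ξ' := by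
  ext x
  rw [mem_window_iff hξ, mem_window_iff hξ', h]

/-- The avalanche at `i` stays between two consecutive ones, so it cannot pass the ends `A`, `B` of
the larger window. It may alter `A` or `B`, which is why one extra interval on each side is needed.
-/
lemma NLocal.apply_topple {N : ℕ} {f : Config → ℝ} (hf : NLocal N f) {ξ : Config}
    (hξ : ξ ∈ twoSided) {i : ℤ} (hi : i ∉ window (N + 1) ξ) : f (topple i ξ) = f ξ := by
  have hTξ := topple_mem_twoSided hξ i
  rw [mem_window_iff hξ] at hi
  have hW := oneCount_le_iff hξ (N + 1)
  have hA := apply_onePos_neg hξ (N + 1)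
  have hB := apply_onePos_natCast hξ (N + 1)
  have hA0 := onePos_neg_lt_zero ξ (N + 1)
  have hB0 := onePos_natCast_nonneg ξ (N + 1)
  set A := onePos ξ (-((N + 1 : ℕ) : ℤ) - 1)
  set B := onePos ξ ((N + 1 : ℕ) : ℤ)
  rw [hW] at hi
  obtain ⟨a, b, hai, hib, -, -, hab, hT⟩ := exists_topple_eq hξ i
  have hbtw : ∀ y, ξ y = false → y ≤ a ∨ b ≤ y := by
    intro y hy
    by_contra! hc
    simp [hab y hc.1 hc.2] at hy
  have h1 := hbtw A hA
  have h2 := hbtw B hB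
  have hagree : ∀ x, A < x → x < B → topple i ξ x = ξ x := by
    intro x hx hx'
    rw [hT, Function.update_of_ne (by omega), Function.update_of_ne (by omega),
      Function.update_of_ne (by omega)]
  have hcount : ∀ x, A < x → x ≤ B → oneCount (topple i ξ) x = oneCount ξ x := by
    intro x hx hx'
    refine oneCount_congr fun y hy hy' => hagree y (by omega) (by omega)
  have hiff : ∀ x, oneCount (topple i ξ) x ≤ N ↔ oneCount ξ x ≤ N := by
    intro x
    by_cases hx : A < x ∧ x ≤ B
    · rw [hcount x hx.1 hx.2]
    · have h3 := mt (hW x).1 hx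
      have h4 := oneCount_le_topple hξ i x
      omega
  have hwin := window_congr hTξ hξ hiff
  refine hf _ hTξ _ hξ hwin fun x hx => ?_
  rw [hwin, mem_window_iff hξ] at hx
  have hx1 := (hW x).1 (by omega)
  -- `B` could have been changed; it is not in the smaller window, since otherwise `B + 1` would be
  -- in the larger one.
  refine hagree x hx1.1 (lt_of_le_of_ne hx1.2 ?_)
  intro hxB
  have h5 := (hW (x + 1)).1 ((oneCount_add_one_le ξ (x := x) (by omega)).trans (by omega))
  omega

open Classical in
/-- The generator that topples a site `i` at rate one as long as `A i (ξ i)` holds. -/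
def activeGenerator (A : ℤ → Bool → Prop) (f : Config → ℝ) (ξ : Config) : ℝ :=
  ∑' i : ℤ, if A i (ξ i) then f (topple i ξ) - f ξ else 0

lemma activeGenerator_true : activeGenerator (fun _ _ => True) = generator := by
  funext f ξ
  simp [activeGenerator, generator]

section

variable {A : ℤ → Bool → Prop} {N : ℕ} {f : Config → ℝ}

open Classical in
lemma NLocal.activeGenerator_eq_sum (hf : NLocal N f) (A : ℤ → Bool → Prop) {ξ : Config}
    (hξ : ξ ∈ twoSided) : activeGenerator A f ξ =
      ∑ i ∈ window (N + 1) ξ, if A i (ξ i) then f (topple i ξ) - f ξ else 0 := by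
  refine tsum_eq_sum fun i hi => ?_
  rw [hf.apply_topple hξ hi, sub_self, ite_self]

/-- Only sites of the larger window contribute. Their avalanches stay in `[a, b]`, and after one of
them the `N`-window still lies in the original `(N+1)`-window, where the two configurations agree.
-/
lemma NLocal.activeGenerator (hf : NLocal N f) (A : ℤ → Bool → Prop) :
    NLocal (N + 1) (activeGenerator A f) := by
  intro ξ hξ ξ' hξ' hwin hagree
  rw [hf.activeGenerator_eq_sum A hξ, hf.activeGenerator_eq_sum A hξ', ← hwin]
  have hW := oneCount_le_iff hξ (N + 1)
  have hW' := oneCount_le_iff hξ' (N + 1)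
  have hA := apply_onePos_neg hξ (N + 1)
  have hB := apply_onePos_natCast hξ (N + 1)
  have hA' := apply_onePos_neg hξ' (N + 1)
  have hA0 := onePos_neg_lt_zero ξ (N + 1)
  have hB0 := onePos_natCast_nonneg ξ (N + 1)
  have hWW : ∀ x, oneCount ξ x ≤ N + 1 ↔ oneCount ξ' x ≤ N + 1 := by
    intro x
    rw [← mem_window_iff hξ, ← mem_window_iff hξ', hwin]
  set a := onePos ξ (-((N + 1 : ℕ) : ℤ) - 1)
  set b := onePos ξ ((N + 1 : ℕ) : ℤ)
  set a' := onePos ξ' (-((N + 1 : ℕ) : ℤ) - 1)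
  set b' := onePos ξ' ((N + 1 : ℕ) : ℤ)
  have hiff : ∀ x, (a < x ∧ x ≤ b) ↔ (a' < x ∧ x ≤ b') := fun x => by
    rw [← hW, ← hW', hWW]
  -- The left end `a` is outside the half-open window but takes part in avalanches. Equal windows
  -- have equal left ends, and both configurations have a 1 there.
  have haa : a = a' := by
    have h1 := hiff (a + 1)
    have h2 := hiff (a' + 1)
    omega
  have hag : ∀ x, a ≤ x → x ≤ b → ξ x = ξ' x := by
    intro x hx hx'
    rcases hx.eq_or_lt with rfl | hx
    · rw [hA, haa, hA']
    · exact hagree x ((mem_window_iff hξ _ _).2 ((hW x).2 ⟨hx, hx'⟩))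
  refine Finset.sum_congr rfl fun i hi => ?_
  rw [← hagree i hi]
  have hfξ : f ξ = f ξ' := by
    refine hf _ hξ _ hξ' (window_congr hξ hξ' fun x => ?_) fun x hx =>
      hagree x (window_mono hξ (Nat.le_succ N) hx)
    by_cases hx : a < x ∧ x ≤ b
    · rw [oneCount_congr fun y hy hy' => hag y (by omega) (by omega)]
    · have h1 := mt (hW x).1 hx
      have h2 := mt (hWW x).2 h1
      omega
  rw [mem_window_iff hξ] at hi
  have hi' := (hW i).1 hi
  have hTag := topple_congr hξ hξ' hA hB hi'.1 hi'.2 hag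
  have hTξ := topple_mem_twoSided hξ i
  have hTξ' := topple_mem_twoSided hξ' i
  have hfT : f (topple i ξ) = f (topple i ξ') := by
    refine hf _ hTξ _ hTξ' (window_congr hTξ hTξ' fun x => ?_) fun x hx => ?_
    · by_cases hx : a < x ∧ x ≤ b
      · rw [oneCount_congr fun y hy hy' => hTag y (by omega) (by omega)]
      · have h1 := mt (hW x).1 hx
        have h2 := mt (hWW x).2 h1
        have h3 := oneCount_le_topple hξ i x
        have h4 := oneCount_le_topple hξ' i x
        omega
    · rw [mem_window_iff hTξ] at hx
      have h3 := oneCount_le_topple hξ i x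
      have h4 := (hW x).1 (by omega)
      exact hTag x h4.1.le h4.2
  rw [hfξ, hfT]

/-! ### Growth and continuity of the iterated generator -/

lemma NLocal.iterate (hf : NLocal N f) (A : ℤ → Bool → Prop) (k : ℕ) :
    NLocal (N + k) ((Sandpile.activeGenerator A)^[k] f) := by
  induction k with
  | zero => exact hf
  | succ k ih =>
    rw [Function.iterate_succ_apply']
    exact ih.activeGenerator A

lemma window_topple_subset {ξ : Config} (hξ : ξ ∈ twoSided) (i : ℤ) (M : ℕ) :
    window M (topple i ξ) ⊆ window (M + 1) ξ := by
  intro x hx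
  rw [mem_window_iff (topple_mem_twoSided hξ i)] at hx
  rw [mem_window_iff hξ]
  exact (oneCount_le_topple hξ i x).trans (by omega)

/-- Fewer ones make larger windows, so bounds at `η` control every configuration below it. -/
lemma window_anti {ξ η : Config} (hξ : ξ ∈ twoSided) (hη : η ∈ twoSided) (h : ξ ≤ η) (M : ℕ) :
    window M ξ ⊆ window M η := by
  intro x hx
  rw [mem_window_iff hξ] at hx
  rw [mem_window_iff hη]
  exact (oneCount_anti h x).trans hx

/-- Every application of the generator costs a factor of twice the size of the window. -/
lemma NLocal.abs_iterate_le (hf : NLocal N f) {C : ℝ} (hC : ∀ ξ ∈ twoSided, |f ξ| ≤ C)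
    (A : ℤ → Bool → Prop) (k : ℕ) {ξ : Config} (hξ : ξ ∈ twoSided) :
    |(Sandpile.activeGenerator A)^[k] f ξ| ≤ C * (2 * (window (N + k) ξ).card) ^ k := by
  classical
  induction k generalizing ξ with
  | zero => simpa using hC ξ hξ
  | succ k ih =>
    have hC0 : 0 ≤ C := (abs_nonneg _).trans (hC ξ hξ)
    rw [Function.iterate_succ_apply', (hf.iterate A k).activeGenerator_eq_sum A hξ]
    refine (Finset.abs_sum_le_sum_abs _ _).trans ?_
    set W := (window (N + k + 1) ξ).card with hW
    have hterm : ∀ i ∈ window (N + k + 1) ξ,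
        |if A i (ξ i) then (Sandpile.activeGenerator A)^[k] f (topple i ξ) -
          (Sandpile.activeGenerator A)^[k] f ξ else 0| ≤ 2 * (C * (2 * (W : ℝ)) ^ k) := by
      intro i _
      have h1 := ih (topple_mem_twoSided hξ i)
      have h2 := ih hξ
      have e1 : ((window (N + k) (topple i ξ)).card : ℝ) ≤ W :=
        Nat.cast_le.2 (Finset.card_le_card (window_topple_subset hξ i _))
      have e2 : ((window (N + k) ξ).card : ℝ) ≤ W :=
        Nat.cast_le.2 (Finset.card_le_card (window_mono hξ (Nat.le_succ _)))
      have h1' : |(Sandpile.activeGenerator A)^[k] f (topple i ξ)| ≤ C * (2 * (W : ℝ)) ^ k :=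
        h1.trans (by gcongr)
      have h2' : |(Sandpile.activeGenerator A)^[k] f ξ| ≤ C * (2 * (W : ℝ)) ^ k :=
        h2.trans (by gcongr)
      split_ifs
      · refine (abs_sub _ _).trans ?_
        linarith
      · rw [abs_zero]
        positivity
    refine (Finset.sum_le_sum hterm).trans (le_of_eq ?_)
    rw [Finset.sum_const, nsmul_eq_mul, ← hW, ← add_assoc, ← hW]
    ring

/-- With a common `N`, all the sums run over the same finite window, so pointwise convergence
suffices. It serves both for the rules of the chains as `n → ∞` and for the cutoffs of `f`. -/
lemma tendsto_activeGenerator {ι : Type*} {l : Filter ι} {B : ι → ℤ → Bool → Prop}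
    {g : ι → Config → ℝ} (hB : ∀ i b, ∀ᶠ n in l, B n i b ↔ A i b) (hg : ∀ n, NLocal N (g n))
    (hf : NLocal N f) (h : ∀ ξ ∈ twoSided, Tendsto (fun n => g n ξ) l (𝓝 (f ξ)))
    {ξ : Config} (hξ : ξ ∈ twoSided) :
    Tendsto (fun n => Sandpile.activeGenerator (B n) (g n) ξ) l
      (𝓝 (Sandpile.activeGenerator A f ξ)) := by
  classical
  simp_rw [fun n => (hg n).activeGenerator_eq_sum (B n) hξ]
  rw [hf.activeGenerator_eq_sum A hξ]
  refine tendsto_finsetSum _ fun i _ => ?_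
  have h1 : Tendsto (fun n => if A i (ξ i) then g n (topple i ξ) - g n ξ else 0) l
      (𝓝 (if A i (ξ i) then f (topple i ξ) - f ξ else 0)) := by
    split_ifs
    · exact (h _ (topple_mem_twoSided hξ i)).sub (h _ hξ)
    · exact tendsto_const_nhds
  refine h1.congr' ?_
  filter_upwards [hB i (ξ i)] with n hn
  simp [hn]

lemma tendsto_iterate {ι : Type*} {l : Filter ι} {B : ι → ℤ → Bool → Prop}
    {g : ι → Config → ℝ} (hB : ∀ i b, ∀ᶠ n in l, B n i b ↔ A i b) (hg : ∀ n, NLocal N (g n))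
    (hf : NLocal N f) (h : ∀ ξ ∈ twoSided, Tendsto (fun n => g n ξ) l (𝓝 (f ξ)))
    (k : ℕ) {ξ : Config} (hξ : ξ ∈ twoSided) :
    Tendsto (fun n => (Sandpile.activeGenerator (B n))^[k] (g n) ξ) l
      (𝓝 ((Sandpile.activeGenerator A)^[k] f ξ)) := by
  induction k generalizing ξ with
  | zero => exact h ξ hξ
  | succ k ih =>
    simp_rw [Function.iterate_succ_apply']
    exact tendsto_activeGenerator hB (fun n => (hg n).iterate (B n) k) (hf.iterate A k)
      (fun ζ hζ => ih hζ) hξ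

end

/-- Configurations that agree on `[-K, K)` have the same window if it lies inside. -/
lemma window_eq_of_agree {ξ ξ' : Config} (hξ : ξ ∈ twoSided) (hξ' : ξ' ∈ twoSided) {M K : ℕ}
    (h : ∀ x : ℤ, -(K : ℤ) ≤ x → x < K → ξ x = ξ' x)
    (hr : M < oneCount ξ K) (hl : M < oneCount ξ (-(K : ℤ))) :
    window M ξ = window M ξ' ∧ ∀ x ∈ window M ξ, ξ x = ξ' x := by
  have hc : ∀ x : ℤ, -(K : ℤ) ≤ x → x ≤ K → oneCount ξ x = oneCount ξ' x := fun x hx hx' =>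
    oneCount_congr fun y hy hy' => h y (by omega) (by omega)
  have hr' := hc K (by omega) le_rfl
  have hl' := hc (-K) le_rfl (by omega)
  constructor
  · refine window_congr hξ hξ' fun x => ?_
    rcases le_or_gt x (-(K : ℤ)) with h1 | h1
    · have h2 := oneCount_mono_left ξ (by omega) h1
      have h3 := oneCount_mono_left ξ' (by omega) h1
      omega
    rcases le_or_gt (K : ℤ) x with h4 | h4
    · have h2 := oneCount_mono_right ξ (by omega) h4
      have h3 := oneCount_mono_right ξ' (by omega) h4
      omega
    rw [hc x h1.le h4.le]
  · intro x hx
    rw [mem_window_iff hξ] at hx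
    refine h x ?_ ?_
    · by_contra! h1
      have h2 := oneCount_mono_left ξ (by omega) h1.le
      omega
    · by_contra! h1
      have h2 := oneCount_mono_right ξ (by omega) h1
      omega

lemma eventually_lt_oneCount {ξ : Config} (hξ : ξ ∈ twoSided) (M : ℕ) :
    ∀ᶠ K : ℕ in atTop, M < oneCount ξ K ∧ M < oneCount ξ (-(K : ℤ)) := by
  have h := oneCount_le_iff hξ M
  filter_upwards [eventually_gt_atTop (max (onePos ξ M).natAbs
    (onePos ξ (-(M : ℤ) - 1)).natAbs)] with K hK
  have h1 := h K
  have h2 := h (-K)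
  constructor <;> omega

lemma eventually_agree {ξ : ℕ → Config} {η : Config} (h : Tendsto ξ atTop (𝓝 η)) (K : ℕ) :
    ∀ᶠ m in atTop, ∀ x : ℤ, -(K : ℤ) ≤ x → x < K → η x = ξ m x := by
  have h1 : ∀ x ∈ Finset.Ico (-(K : ℤ)) K, ∀ᶠ m in atTop, η x = ξ m x := by
    intro x _
    have := (tendsto_pi_nhds.1 h x).eventually (eventually_mem_nhds_iff.2
      (show {η x} ∈ 𝓝 (η x) by simp))
    filter_upwards [this] with m hm
    simpa [eq_comm] using hm
  filter_upwards [(Finset.eventually_all _).2 h1] with m hm x hx hx'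
  exact hm x (Finset.mem_Ico.2 ⟨hx, hx'⟩)

lemma NLocal.eventually_eq {M : ℕ} {f : Config → ℝ} (hf : NLocal M f) {ξ : ℕ → Config}
    {η : Config} (hη : η ∈ twoSided) (hξ : ∀ m, ξ m ∈ twoSided) (h : Tendsto ξ atTop (𝓝 η)) :
    ∀ᶠ m in atTop, f (ξ m) = f η := by
  obtain ⟨K, hK⟩ := (eventually_lt_oneCount hη M).exists
  filter_upwards [eventually_agree h K] with m hm
  obtain ⟨h1, h2⟩ := window_eq_of_agree hη (hξ m) hm hK.1 hK.2
  exact (hf _ hη _ (hξ m) h1 h2).symm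

/-! ### The approximating chains on finite configurations -/

/-- The activity rule of the `n`-th chain. -/
def chainRule (n : ℕ) (i : ℤ) (b : Bool) : Prop := b = true ∨ (-(n : ℤ) ≤ i ∧ i ≤ (n : ℤ))

/-- An upper bound, less one, for the number of active sites. -/
def critBound (n : ℕ) (ξ : Config) : ℕ := {x : ℤ | ξ x = true}.ncard + 2 * n

/-- `a` and `b` become critical, while the reflected place, which is `a` or a site already critical,
ends with height 1: a net gain of at most one. -/
lemma topple_finite_and_ncard_le {ξ : Config} (hξ : ξ ∈ finiteConfigs) (i : ℤ) :
    topple i ξ ∈ finiteConfigs ∧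
      {x : ℤ | topple i ξ x = true}.ncard ≤ {x : ℤ | ξ x = true}.ncard + 1 := by
  obtain ⟨a, b, hai, hib, -, -, hab, hT⟩ := exists_topple_eq (finiteConfigs_subset_twoSided hξ) i
  have hfin : {x : ℤ | ξ x = true}.Finite := hξ
  set S := insert b (insert a hfin.toFinset) with hS
  have hc : a + b - i ∈ S := by
    simp only [hS, Finset.mem_insert, Set.Finite.mem_toFinset, Set.mem_ofPred_eq]
    by_cases h : i = b
    · exact Or.inr (Or.inl (by omega))
    · exact Or.inr (Or.inr (hab _ (by omega) (by omega)))
  have hsub : {x : ℤ | topple i ξ x = true} ⊆ (S.erase (a + b - i) : Finset ℤ) := by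
    intro x hx
    have hx' : topple i ξ x = true := hx
    rw [hT] at hx'
    simp only [Function.update_apply] at hx'
    simp only [hS, Finset.mem_coe, Finset.mem_erase, Finset.mem_insert, Set.Finite.mem_toFinset,
      Set.mem_ofPred_eq]
    split_ifs at hx' <;> tauto
  refine ⟨(Finset.finite_toSet _).subset hsub, ?_⟩
  have h1 := Set.ncard_le_ncard hsub (Finset.finite_toSet _)
  rw [Set.ncard_coe_finset] at h1
  have h2 := Finset.card_erase_add_one hc
  have h3 := Finset.card_insert_le b (insert a hfin.toFinset)
  have h4 := Finset.card_insert_le a hfin.toFinset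
  rw [← hS] at h3
  rw [Set.ncard_eq_toFinset_card _ hfin]
  omega

lemma topple_mem_finiteConfigs {ξ : Config} (hξ : ξ ∈ finiteConfigs) (i : ℤ) :
    topple i ξ ∈ finiteConfigs := (topple_finite_and_ncard_le hξ i).1

lemma critBound_topple_le {ξ : Config} (hξ : ξ ∈ finiteConfigs) (n : ℕ) (i : ℤ) :
    critBound n (topple i ξ) ≤ critBound n ξ + 1 := by
  have := (topple_finite_and_ncard_le hξ i).2
  unfold critBound
  omega

lemma activeSites_eq (n : ℕ) (ξ : Config) :
    activeSites n ξ = {x : ℤ | ξ x = true} ∪ (Finset.Icc (-(n : ℤ)) n : Finset ℤ) := by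
  ext i
  simp [activeSites]

lemma activeSites_finite (n : ℕ) {ξ : Config} (hξ : ξ ∈ finiteConfigs) :
    (activeSites n ξ).Finite := by
  rw [activeSites_eq]
  exact Set.Finite.union hξ (Finset.finite_toSet _)

open Classical in
/-- The active sites as a finite set (empty if there are infinitely many). -/
def activeFinset (n : ℕ) (ξ : Config) : Finset ℤ :=
  if h : (activeSites n ξ).Finite then h.toFinset else ∅

section

variable {ξ : Config} (hξ : ξ ∈ finiteConfigs) (n : ℕ)
include hξ

lemma coe_activeFinset : (activeFinset n ξ : Set ℤ) = activeSites n ξ := by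
  simp [activeFinset, activeSites_finite n hξ]

lemma mem_activeFinset (i : ℤ) : i ∈ activeFinset n ξ ↔ chainRule n i (ξ i) := by
  rw [← Finset.mem_coe, coe_activeFinset hξ]
  rfl

lemma jumpRate_eq : jumpRate n ξ = (activeFinset n ξ).card := by
  rw [jumpRate, ← coe_activeFinset hξ, Set.ncard_coe_finset]

lemma card_activeFinset_le : (activeFinset n ξ).card ≤ critBound n ξ + 1 := by
  rw [← Set.ncard_coe_finset, coe_activeFinset hξ, activeSites_eq]
  refine (Set.ncard_union_le _ _).trans ?_
  rw [Set.ncard_coe_finset, Int.card_Icc, critBound]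
  omega

lemma tsum_activeSites (g : ℤ → ℝ≥0∞) :
    ∑' i : activeSites n ξ, g i = ∑ i ∈ activeFinset n ξ, g i := by
  rw [← Finset.tsum_subtype', coe_activeFinset hξ]

lemma activeGenerator_chainRule (f : Config → ℝ) :
    activeGenerator (chainRule n) f ξ = ∑ i ∈ activeFinset n ξ, (f (topple i ξ) - f ξ) := by
  classical
  rw [activeGenerator, tsum_eq_sum (s := activeFinset n ξ)]
  · refine Finset.sum_congr rfl fun i hi => ?_
    rw [if_pos ((mem_activeFinset hξ n i).1 hi)]
  · intro i hi
    rw [if_neg (mt (mem_activeFinset hξ n i).2 hi)]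

end

/-! ### The exponential series of the generator of a chain -/

/-- The terms of the exponential series of the generator with activity rule `A`. -/
def expTerm (A : ℤ → Bool → Prop) (f : Config → ℝ) (t : ℝ) (ξ : Config) (k : ℕ) : ℝ :=
  t ^ k * (activeGenerator A)^[k] f ξ / (k ! : ℝ)

/-- The exponential series of the generator with activity rule `A`. -/
def expSeries (A : ℤ → Bool → Prop) (f : Config → ℝ) (t : ℝ) (ξ : Config) : ℝ :=
  ∑' k, expTerm A f t ξ k

lemma expSeries_zero (A : ℤ → Bool → Prop) (f : Config → ℝ) (ξ : Config) :
    expSeries A f 0 ξ = f ξ := by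
  rw [expSeries, tsum_eq_single 0]
  · simp [expTerm]
  · intro k hk
    simp [expTerm, hk]

section

variable {n : ℕ} {f : Config → ℝ} {C : ℝ}

/-- Each application sums at most `p + 1` differences and raises `p` by at most one, whence the
rising factorial. A free upper bound `p` lets the induction treat `ξ` and its topplings alike. -/
lemma abs_iterate_chain_le (hf : ∀ ξ ∈ finiteConfigs, |f ξ| ≤ C) (k : ℕ) {ξ : Config}
    (hξ : ξ ∈ finiteConfigs) {p : ℕ} (hp : critBound n ξ ≤ p) :
    |(activeGenerator (chainRule n))^[k] f ξ| ≤ C * 2 ^ k * (p + 1).ascFactorial k := by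
  induction k generalizing ξ p with
  | zero => simpa using hf ξ hξ
  | succ k ih =>
    have hC0 : 0 ≤ C := (abs_nonneg _).trans (hf ξ hξ)
    rw [Function.iterate_succ_apply', activeGenerator_chainRule hξ]
    refine (Finset.abs_sum_le_sum_abs _ _).trans ?_
    have hterm : ∀ i ∈ activeFinset n ξ,
        |(activeGenerator (chainRule n))^[k] f (topple i ξ) -
          (activeGenerator (chainRule n))^[k] f ξ| ≤
        2 * (C * 2 ^ k * (p + 1 + 1).ascFactorial k) := by
      intro i _
      refine (abs_sub _ _).trans ?_
      have h1 := ih (topple_mem_finiteConfigs hξ i)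
        ((critBound_topple_le hξ n i).trans (Nat.add_le_add_right hp 1))
      have h2 := ih hξ (hp.trans (Nat.le_succ p))
      linarith
    refine (Finset.sum_le_sum hterm).trans ?_
    rw [Finset.sum_const, nsmul_eq_mul]
    have hc : ((activeFinset n ξ).card : ℝ) ≤ (p + 1 : ℕ) :=
      Nat.cast_le.2 ((card_activeFinset_le hξ n).trans (Nat.add_le_add_right hp 1))
    have e : (p + 1).ascFactorial (k + 1) = (p + 1) * (p + 1 + 1).ascFactorial k := by
      rw [Nat.succ_ascFactorial, Nat.ascFactorial_succ]
    rw [e]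
    calc ((activeFinset n ξ).card : ℝ) * (2 * (C * 2 ^ k * (p + 1 + 1).ascFactorial k))
        ≤ (p + 1 : ℕ) * (2 * (C * 2 ^ k * (p + 1 + 1).ascFactorial k)) := by gcongr
      _ = _ := by push_cast; ring

variable (hf : ∀ ξ ∈ finiteConfigs, |f ξ| ≤ C)
include hf

/-- Dividing the rising factorial by `k!` leaves a binomial coefficient, so the majorant is the
series of `(1 - 2|t|)^(-(p+1))` with `p = critBound n ξ`; this is the source of `t < 1/2`. -/
lemma abs_expTerm_chain_le (t : ℝ) {ξ : Config} (hξ : ξ ∈ finiteConfigs) (k : ℕ) :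
    |expTerm (chainRule n) f t ξ k| ≤
      C * (((k + critBound n ξ).choose (critBound n ξ) : ℝ) * (2 * |t|) ^ k) := by
  have h := abs_iterate_chain_le hf k hξ (le_refl (critBound n ξ))
  rw [expTerm, abs_div, abs_mul, abs_pow, Nat.abs_cast, div_le_iff₀ (by positivity)]
  rw [Nat.ascFactorial_eq_factorial_mul_choose, Nat.choose_symm_add.symm, add_comm _ k,
    Nat.cast_mul] at h
  calc |t| ^ k * |(activeGenerator (chainRule n))^[k] f ξ|
      ≤ |t| ^ k * (C * 2 ^ k * (k ! * ((k + critBound n ξ).choose (critBound n ξ) : ℕ))) := by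
        gcongr
    _ = _ := by rw [mul_pow]; ring

lemma summable_expTerm_chain {t : ℝ} (ht : |t| < 1 / 2) {ξ : Config} (hξ : ξ ∈ finiteConfigs) :
    Summable fun k => |expTerm (chainRule n) f t ξ k| := by
  have h := (summable_choose_mul_geometric_of_norm_lt_one (critBound n ξ) (r := 2 * |t|)
    (by rw [Real.norm_of_nonneg (by positivity)]; linarith)).mul_left C
  exact Summable.of_nonneg_of_le (fun _ => abs_nonneg _) (abs_expTerm_chain_le hf t hξ) h

lemma abs_expSeries_chain_le {t : ℝ} (ht0 : 0 ≤ t) (ht : t < 1 / 2) {ξ : Config}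
    (hξ : ξ ∈ finiteConfigs) :
    |expSeries (chainRule n) f t ξ| ≤ C * (1 / (1 - 2 * t) ^ (critBound n ξ + 1)) := by
  have h := (hasSum_choose_mul_geometric_of_norm_lt_one (critBound n ξ) (r := 2 * |t|)
    (by rw [Real.norm_of_nonneg (by positivity), abs_of_nonneg ht0]; linarith)).mul_left C
  have h2 := tsum_of_norm_bounded (f := expTerm (chainRule n) f t ξ) h
    (abs_expTerm_chain_le (n := n) hf t hξ)
  rwa [abs_of_nonneg ht0] at h2

/-- The backward equation, by termwise differentiation on a ball of radius `r` between `|t|` and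
`1/2`. -/
lemma hasDerivAt_expSeries_chain {t : ℝ} (ht : |t| < 1 / 2) {ξ : Config}
    (hξ : ξ ∈ finiteConfigs) :
    HasDerivAt (fun t => expSeries (chainRule n) f t ξ)
      (∑ i ∈ activeFinset n ξ, (expSeries (chainRule n) f t (topple i ξ) -
        expSeries (chainRule n) f t ξ)) t := by
  set L := activeGenerator (chainRule n) with hL
  obtain ⟨r, hr, hr'⟩ := exists_between ht
  have hr0 : 0 ≤ r := (abs_nonneg t).trans hr.le
  have hrr : |r| < 1 / 2 := by rwa [abs_of_nonneg hr0]
  -- The differentiated series is a finite combination of exponential series at `ξ` and its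
  -- topplings, so its summability needs no new estimate.
  have hstep : ∀ (s : ℝ) (k : ℕ), s ^ k * L^[k + 1] f ξ / (k ! : ℝ) =
      ∑ i ∈ activeFinset n ξ, (expTerm (chainRule n) f s (topple i ξ) k -
        expTerm (chainRule n) f s ξ k) := by
    intro s k
    rw [Function.iterate_succ_apply', hL, activeGenerator_chainRule hξ, Finset.mul_sum,
      Finset.sum_div]
    refine Finset.sum_congr rfl fun i _ => ?_
    rw [expTerm, expTerm]
    ring
  have hsum : ∀ s : ℝ, |s| < 1 / 2 → ∀ ζ ∈ finiteConfigs,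
      Summable (expTerm (chainRule n) f s ζ) := fun s hs ζ hζ =>
    (summable_expTerm_chain hf hs hζ).of_abs
  have hshift : ∀ (s : ℝ) (k : ℕ), ((k + 1 : ℕ) : ℝ) * s ^ (k + 1 - 1) * L^[k + 1] f ξ /
      ((k + 1)! : ℝ) = s ^ k * L^[k + 1] f ξ / (k ! : ℝ) := by
    intro s k
    rw [Nat.factorial_succ, Nat.add_sub_cancel]
    push_cast
    field_simp
  have hu : Summable fun k : ℕ => |(k : ℝ) * r ^ (k - 1) * L^[k] f ξ / (k ! : ℝ)| := by
    rw [← summable_nat_add_iff 1]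
    simp_rw [hshift, hstep]
    refine Summable.of_nonneg_of_le (fun _ => abs_nonneg _)
      (fun k => Finset.abs_sum_le_sum_abs _ _) ?_
    refine summable_sum fun i _ => ?_
    exact ((hsum r hrr _ (topple_mem_finiteConfigs hξ i)).sub (hsum r hrr _ hξ)).abs
  have key := hasDerivAt_tsum_of_isPreconnected (y₀ := t) (y := t)
    (g := fun k s => expTerm (chainRule n) f s ξ k)
    (g' := fun k s => (k : ℝ) * s ^ (k - 1) * L^[k] f ξ / (k ! : ℝ)) hu
    (Metric.isOpen_ball (x := (0 : ℝ)) (ε := r)) (convex_ball _ _).isPreconnected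
    (fun k s _ => ((hasDerivAt_pow k s).mul_const _).div_const _) ?_ (by simpa using hr)
    (hsum t ht ξ hξ) (by simpa using hr)
  · refine key.congr_deriv ?_
    have hs' : Summable fun k : ℕ => (k : ℝ) * t ^ (k - 1) * L^[k] f ξ / (k ! : ℝ) := by
      rw [← summable_nat_add_iff 1]
      simp_rw [hshift, hstep]
      exact summable_sum fun i _ =>
        (hsum t ht _ (topple_mem_finiteConfigs hξ i)).sub (hsum t ht _ hξ)
    rw [hs'.tsum_eq_zero_add]
    simp_rw [hshift, hstep]
    rw [Summable.tsum_finsetSum fun i _ =>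
      (hsum t ht _ (topple_mem_finiteConfigs hξ i)).sub (hsum t ht _ hξ)]
    simp only [Nat.cast_zero, zero_mul, zero_div, zero_add]
    refine Finset.sum_congr rfl fun i _ => ?_
    exact (hsum t ht _ (topple_mem_finiteConfigs hξ i)).tsum_sub (hsum t ht _ hξ)
  · intro k s hs
    have hs' : |s| ≤ |r| := by
      rw [abs_of_nonneg hr0]
      simpa using (mem_ball_zero_iff.1 hs).le
    rw [Real.norm_eq_abs, abs_div, abs_mul, abs_mul, abs_pow, abs_div, abs_mul, abs_mul, abs_pow]
    gcongr

lemma continuousOn_expSeries_chain {ξ : Config} (hξ : ξ ∈ finiteConfigs) :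
    ContinuousOn (fun t => expSeries (chainRule n) f t ξ) (Set.Ioo (-(1 / 2)) (1 / 2)) :=
  fun _ ht => (hasDerivAt_expSeries_chain hf (abs_lt.2 ht) hξ).continuousAt.continuousWithinAt

/-- The backward equation in integral form. -/
lemma expSeries_chain_eq_integral {t : ℝ} (ht0 : 0 ≤ t) (ht : t < 1 / 2) {ξ : Config}
    (hξ : ξ ∈ finiteConfigs) :
    ContinuousOn (fun s => Real.exp (-(jumpRate n ξ * s)) *
      ∑ i ∈ activeFinset n ξ, expSeries (chainRule n) f (t - s) (topple i ξ)) (Set.Icc 0 t) ∧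
    expSeries (chainRule n) f t ξ = Real.exp (-(jumpRate n ξ * t)) * f ξ +
      ∫ s in (0 : ℝ)..t, Real.exp (-(jumpRate n ξ * s)) *
        ∑ i ∈ activeFinset n ξ, expSeries (chainRule n) f (t - s) (topple i ξ) := by
  set c := jumpRate n ξ with hc
  set v := expSeries (chainRule n) f with hv
  have hcont : ContinuousOn (fun s => Real.exp (-(c * s)) *
      ∑ i ∈ activeFinset n ξ, v (t - s) (topple i ξ)) (Set.Icc 0 t) := by
    refine ContinuousOn.mul (by fun_prop) (continuousOn_finsetSum _ fun i _ => ?_)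
    refine (continuousOn_expSeries_chain (n := n) hf (topple_mem_finiteConfigs hξ i)).comp
      (by fun_prop) ?_
    rintro s ⟨hs, hs'⟩
    exact ⟨by linarith, by linarith⟩
  refine ⟨hcont, ?_⟩
  -- The factor `exp (-c s)` cancels the diagonal part of the generator, because `c` is the number
  -- of active sites.
  have hderiv : ∀ s ∈ Set.uIcc 0 t, HasDerivAt (fun s => Real.exp (-(c * s)) * v (t - s) ξ)
      (-(Real.exp (-(c * s)) * ∑ i ∈ activeFinset n ξ, v (t - s) (topple i ξ))) s := by
    intro s hs
    rw [Set.uIcc_of_le ht0] at hs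
    have h1 : |t - s| < 1 / 2 := by
      rw [abs_lt]
      exact ⟨by linarith [hs.2], by linarith [hs.1]⟩
    have h2 := (hasDerivAt_expSeries_chain (n := n) hf h1 hξ).comp s
      ((hasDerivAt_id s).const_sub t)
    have h3 : HasDerivAt (fun s => Real.exp (-(c * s))) (Real.exp (-(c * s)) * (-(c * 1))) s :=
      (((hasDerivAt_id s).const_mul c).neg).exp
    refine (h3.mul h2).congr_deriv ?_
    rw [Finset.sum_sub_distrib, Finset.sum_const, nsmul_eq_mul, ← jumpRate_eq hξ, ← hc, ← hv]
    simp only [Function.comp]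
    ring
  have hint := intervalIntegral.integral_eq_sub_of_hasDerivAt hderiv
    (by
      refine ContinuousOn.intervalIntegrable ?_
      rw [Set.uIcc_of_le ht0]
      exact hcont.neg)
  rw [intervalIntegral.integral_neg] at hint
  simp only [sub_self, mul_zero, neg_zero, Real.exp_zero, one_mul, sub_zero] at hint
  have h0 : v 0 ξ = f ξ := expSeries_zero _ _ _
  rw [h0] at hint
  linarith

end

/-! ### Convergence of Feller's construction to the exponential series -/

/-- A bound for the error of the `m`-th Feller iterate. -/
def errorBound (C : ℝ) (m : ℕ) (t : ℝ) (q : ℕ) : ℝ := C / 2 ^ m * ((1 - 2 * t) ^ (q + 1))⁻¹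

lemma errorBound_nonneg {C : ℝ} (hC : 0 ≤ C) (m : ℕ) {t : ℝ} (ht : t < 1 / 2) (q : ℕ) :
    0 ≤ errorBound C m t q := by
  have : 0 < 1 - 2 * t := by linarith
  unfold errorBound
  positivity

lemma errorBound_mono {C : ℝ} (hC : 0 ≤ C) (m : ℕ) {t : ℝ} (ht0 : 0 ≤ t) (ht : t < 1 / 2)
    {q q' : ℕ} (h : q ≤ q') : errorBound C m t q ≤ errorBound C m t q' := by
  have h0 : 0 < 1 - 2 * t := by linarith
  unfold errorBound
  refine mul_le_mul_of_nonneg_left (inv_anti₀ (by positivity) ?_) (by positivity)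
  exact pow_le_pow_of_le_one h0.le (by linarith) (by omega)

lemma continuousOn_errorBound (C : ℝ) (m : ℕ) {t : ℝ} (ht : t < 1 / 2) (q : ℕ) :
    ContinuousOn (fun s => errorBound C m (t - s) q) (Set.Icc 0 t) := by
  unfold errorBound
  refine continuousOn_const.mul (ContinuousOn.inv₀ (by fun_prop) ?_)
  rintro s ⟨hs, hs'⟩
  have : 0 < 1 - 2 * (t - s) := by linarith
  positivity

lemma continuousOn_exp_mul_errorBound (C : ℝ) (m : ℕ) {t : ℝ} (ht : t < 1 / 2) (q : ℕ) (c : ℝ) :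
    ContinuousOn (fun s => Real.exp (-(c * s)) * (c * errorBound C m (t - s) q))
      (Set.Icc 0 t) :=
  ContinuousOn.mul (by fun_prop) (continuousOn_const.mul (continuousOn_errorBound C m ht q))

/-- Since `(1 - 2t)^(-(q+1))` has derivative `2 (q+1) (1 - 2t)^(-(q+2))`, integrating at rate at
most `q + 1` against the bound for `q + 1` gives at most half the bound for `q`. This gains the
factor `1/2` from `m` to `m + 1`. -/
lemma integral_errorBound_le {C : ℝ} (hC : 0 ≤ C) (m : ℕ) {t : ℝ} (ht0 : 0 ≤ t) (ht : t < 1 / 2)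
    (q : ℕ) {c : ℝ} (hc0 : 0 ≤ c) (hc : c ≤ q + 1) :
    ∫ s in (0 : ℝ)..t, Real.exp (-(c * s)) * (c * errorBound C m (t - s) (q + 1)) ≤
      errorBound C (m + 1) t q := by
  have hcont := continuousOn_errorBound C m ht (q + 1)
  have h1 : ∫ s in (0 : ℝ)..t, Real.exp (-(c * s)) * (c * errorBound C m (t - s) (q + 1)) ≤
      ∫ s in (0 : ℝ)..t, (q + 1) * errorBound C m (t - s) (q + 1) := by
    refine intervalIntegral.integral_mono_on ht0 ?_ ?_ ?_
    · refine ContinuousOn.intervalIntegrable ?_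
      rw [Set.uIcc_of_le ht0]
      exact continuousOn_exp_mul_errorBound C m ht (q + 1) c
    · refine ContinuousOn.intervalIntegrable ?_
      rw [Set.uIcc_of_le ht0]
      exact continuousOn_const.mul hcont
    · rintro s ⟨hs, hs'⟩
      have h2 := errorBound_nonneg hC m (show t - s < 1 / 2 by linarith) (q + 1)
      have h3 : Real.exp (-(c * s)) ≤ 1 := Real.exp_le_one_iff.2 (by
        have := mul_nonneg hc0 hs
        linarith)
      calc Real.exp (-(c * s)) * (c * errorBound C m (t - s) (q + 1))
          ≤ 1 * (c * errorBound C m (t - s) (q + 1)) := by gcongr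
        _ ≤ (q + 1) * errorBound C m (t - s) (q + 1) := by
          rw [one_mul]
          gcongr
  refine h1.trans ?_
  have hderiv : ∀ s ∈ Set.uIcc 0 t, HasDerivAt (fun s => -errorBound C (m + 1) (t - s) q)
      ((q + 1) * errorBound C m (t - s) (q + 1)) s := by
    intro s hs
    rw [Set.uIcc_of_le ht0] at hs
    have h0 : 0 < 1 - 2 * (t - s) := by linarith [hs.1]
    have h2 : HasDerivAt (fun s => 1 - 2 * (t - s)) 2 s :=
      ((((hasDerivAt_id s).const_sub t).const_mul 2).const_sub 1).congr_deriv (by ring)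
    have h3 := (((h2.fun_pow (q + 1)).fun_inv (by positivity)).const_mul (C / 2 ^ (m + 1))).fun_neg
    unfold errorBound
    refine h3.congr_deriv ?_
    rw [Nat.add_sub_cancel]
    field_simp
    push_cast
    ring
  rw [intervalIntegral.integral_eq_sub_of_hasDerivAt hderiv]
  · have := errorBound_nonneg hC (m + 1) (show t - t < 1 / 2 by linarith) q
    simp only [sub_zero]
    linarith
  · refine ContinuousOn.intervalIntegrable ?_
    rw [Set.uIcc_of_le ht0]
    exact continuousOn_const.mul hcont

section

variable {n : ℕ} {f : Config → ℝ} {C : ℝ} (hf : ∀ ξ ∈ finiteConfigs, |f ξ| ≤ C)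
include hf

/-- A minimum principle: each use of the integral equation halves the possible negative part, so
letting `m → ∞` yields positivity of the series. -/
lemma neg_errorBound_le_expSeries (hf0 : ∀ ξ ∈ finiteConfigs, 0 ≤ f ξ) (m : ℕ) {t : ℝ}
    (ht0 : 0 ≤ t) (ht : t < 1 / 2) {ξ : Config} (hξ : ξ ∈ finiteConfigs) :
    -errorBound C m t (critBound n ξ) ≤ expSeries (chainRule n) f t ξ := by
  have hC : 0 ≤ C := (abs_nonneg _).trans (hf ξ hξ)
  induction m generalizing t ξ with
  | zero =>
    have := abs_expSeries_chain_le (n := n) hf ht0 ht hξ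
    rw [errorBound, pow_zero, div_one, ← one_div]
    exact (abs_le.1 this).1
  | succ m ih =>
    obtain ⟨hcont, h⟩ := expSeries_chain_eq_integral (n := n) hf ht0 ht hξ
    rw [h]
    have hc : jumpRate n ξ ≤ critBound n ξ + 1 := by
      rw [jumpRate_eq hξ]
      exact_mod_cast card_activeFinset_le hξ n
    have hc0 : 0 ≤ jumpRate n ξ := Nat.cast_nonneg _
    have h1 := integral_errorBound_le hC m ht0 ht (critBound n ξ) hc0 hc
    have h2 : -∫ s in (0 : ℝ)..t, Real.exp (-(jumpRate n ξ * s)) *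
        (jumpRate n ξ * errorBound C m (t - s) (critBound n ξ + 1)) ≤
        ∫ s in (0 : ℝ)..t, Real.exp (-(jumpRate n ξ * s)) *
        ∑ i ∈ activeFinset n ξ, expSeries (chainRule n) f (t - s) (topple i ξ) := by
      rw [← intervalIntegral.integral_neg]
      refine intervalIntegral.integral_mono_on ht0 ?_ ?_ ?_
      · refine ContinuousOn.intervalIntegrable ?_
        rw [Set.uIcc_of_le ht0]
        exact (continuousOn_exp_mul_errorBound C m ht _ _).neg
      · refine ContinuousOn.intervalIntegrable ?_
        rwa [Set.uIcc_of_le ht0]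
      · rintro s ⟨hs, hs'⟩
        rw [← mul_neg]
        refine mul_le_mul_of_nonneg_left ?_ (Real.exp_nonneg _)
        rw [← mul_neg, jumpRate_eq hξ, ← nsmul_eq_mul, ← Finset.sum_const]
        refine Finset.sum_le_sum fun i _ => ?_
        refine le_trans (neg_le_neg ?_) (ih (sub_nonneg.2 hs') (by linarith) (topple_mem_finiteConfigs hξ i))
        exact errorBound_mono hC m (sub_nonneg.2 hs') (by linarith) (critBound_topple_le hξ n i)
    have h3 : 0 ≤ Real.exp (-(jumpRate n ξ * t)) * f ξ :=
      mul_nonneg (Real.exp_nonneg _) (hf0 ξ hξ)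
    linarith

end

lemma tendsto_errorBound (C t : ℝ) (q : ℕ) :
    Tendsto (fun m => errorBound C m t q) atTop (𝓝 0) := by
  have h : Tendsto (fun m : ℕ => C * (1 / 2 : ℝ) ^ m * ((1 - 2 * t) ^ (q + 1))⁻¹) atTop
      (𝓝 (C * 0 * ((1 - 2 * t) ^ (q + 1))⁻¹)) :=
    ((tendsto_pow_atTop_nhds_zero_of_lt_one (by norm_num) (by norm_num)).const_mul C).mul_const _
  simp only [mul_zero, zero_mul] at h
  refine h.congr fun m => ?_
  rw [errorBound, one_div, inv_pow, div_eq_mul_inv]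

lemma expSeries_chain_nonneg {n : ℕ} {f : Config → ℝ} {C : ℝ}
    (hf : ∀ ξ ∈ finiteConfigs, |f ξ| ≤ C) (hf0 : ∀ ξ ∈ finiteConfigs, 0 ≤ f ξ) {t : ℝ}
    (ht0 : 0 ≤ t) (ht : t < 1 / 2) {ξ : Config} (hξ : ξ ∈ finiteConfigs) :
    0 ≤ expSeries (chainRule n) f t ξ := by
  have h := (tendsto_errorBound C t (critBound n ξ)).neg
  rw [neg_zero] at h
  exact le_of_tendsto' h fun m => neg_errorBound_le_expSeries hf hf0 m ht0 ht hξ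

/-! ### The Feller iterates -/

lemma measurable_transIter (n m : ℕ) (ξ ζ : Config) :
    Measurable fun t => transIter n m t ξ ζ := by
  induction m generalizing ξ with
  | zero => simp only [transIter]; exact measurable_const
  | succ m ih =>
    simp only [transIter]
    refine Measurable.add (by fun_prop) ?_
    -- The range of integration depends on `t`; an indicator in the plane makes the integrand
    -- jointly measurable over a fixed range.
    have h : Measurable fun p : ℝ × ℝ => {q : ℝ × ℝ | 0 < q.2 ∧ q.2 ≤ q.1}.indicator
        (fun q => ENNReal.ofReal (Real.exp (-(jumpRate n ξ * q.2))) *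
          ∑' i : activeSites n ξ, transIter n m (q.1 - q.2) (topple i ξ) ζ) p := by
      refine Measurable.indicator ?_ ?_
      · refine Measurable.mul (by fun_prop) (Measurable.tsum fun i => ?_)
        exact (ih (topple i ξ)).comp (by fun_prop)
      · exact (measurableSet_lt measurable_const measurable_snd).inter
          (measurableSet_le measurable_snd measurable_fst)
    convert! h.lintegral_prod_right' (ν := volume) using 2 with t
    rw [← lintegral_indicator measurableSet_Ioc]
    rfl

lemma transIter_mono (n : ℕ) (t : ℝ) (ξ ζ : Config) : Monotone fun m => transIter n m t ξ ζ := by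
  refine monotone_nat_of_le_succ fun m => ?_
  induction m generalizing t ξ with
  | zero => simp [transIter]
  | succ m ih =>
    rw [transIter, transIter]
    gcongr
    exact ih _ _

/-- Needed to exchange sums over final configurations with integrals in time. -/
instance : Countable finiteConfigs := by
  refine Function.Injective.countable (β := Finset ℤ)
    (f := fun ξ => Set.Finite.toFinset (s := {x : ℤ | ξ.1 x = true}) ξ.2) ?_
  intro ξ ξ' h
  apply Subtype.ext
  funext x
  have hmem : ∀ ζ : finiteConfigs, x ∈ Set.Finite.toFinset (s := {x : ℤ | ζ.1 x = true}) ζ.2 ↔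
      ζ.1 x = true := fun ζ => Set.Finite.mem_toFinset _
  exact Bool.eq_iff_iff.2 ((hmem ξ).symm.trans ((Finset.ext_iff.1 h x).trans (hmem ξ')))

/-- The `m`-th Feller iterate applied to a nonnegative function. -/
def fellerIter (n m : ℕ) (t : ℝ) (F : Config → ℝ≥0∞) (ξ : Config) : ℝ≥0∞ :=
  ∑' ζ : finiteConfigs, transIter n m t ξ ζ * F ζ

lemma measurable_fellerIter (n m : ℕ) (F : Config → ℝ≥0∞) (ξ : Config) :
    Measurable fun t => fellerIter n m t F ξ :=
  Measurable.tsum fun ζ => (measurable_transIter n m ξ ζ).mul_const _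

lemma fellerIter_succ (n m : ℕ) (t : ℝ) (F : Config → ℝ≥0∞) {ξ : Config}
    (hξ : ξ ∈ finiteConfigs) :
    fellerIter n (m + 1) t F ξ = ENNReal.ofReal (Real.exp (-(jumpRate n ξ * t))) * F ξ +
      ∫⁻ s in Set.Ioc 0 t, ENNReal.ofReal (Real.exp (-(jumpRate n ξ * s))) *
        ∑ i ∈ activeFinset n ξ, fellerIter n m (t - s) F (topple i ξ) := by
  unfold fellerIter
  simp only [transIter, add_mul]
  rw [ENNReal.tsum_add]
  congr 1
  · rw [tsum_eq_single ⟨ξ, hξ⟩]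
    · simp
    · rintro ⟨ζ, hζ⟩ hne
      have : ξ ≠ ζ := fun h => hne (Subtype.ext h.symm)
      simp [this]
  · have hm : ∀ ζ : finiteConfigs, Measurable fun s =>
        ENNReal.ofReal (Real.exp (-(jumpRate n ξ * s))) *
        ∑' i : activeSites n ξ, transIter n m (t - s) (topple i ξ) ζ := by
      intro ζ
      refine Measurable.mul (by fun_prop) (Measurable.tsum fun i => ?_)
      exact (measurable_transIter n m (topple i ξ) ζ).comp (by fun_prop)
    simp_rw [fun ζ : finiteConfigs => (lintegral_mul_const (μ := volume.restrict (Set.Ioc 0 t))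
      (F ζ) (hm ζ)).symm]
    rw [← lintegral_tsum fun ζ => ((hm ζ).mul_const _).aemeasurable]
    refine lintegral_congr fun s => ?_
    simp_rw [mul_assoc]
    rw [ENNReal.tsum_mul_left]
    congr 1
    simp_rw [← ENNReal.tsum_mul_right]
    rw [ENNReal.tsum_comm,
      tsum_activeSites hξ n (fun i => ∑' ζ : finiteConfigs, transIter n m (t - s) (topple i ξ) ζ * F ζ)]

section

variable {n : ℕ} {f : Config → ℝ} {C : ℝ} (hf : ∀ ξ ∈ finiteConfigs, |f ξ| ≤ C)
  (hf0 : ∀ ξ ∈ finiteConfigs, 0 ≤ f ξ)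
include hf hf0

/-- The series is a fixed point of the recursion in `fellerIter_succ`; positivity allows the passage
to `ℝ≥0∞`. -/
lemma ofReal_expSeries_chain_eq {t : ℝ} (ht0 : 0 ≤ t) (ht : t < 1 / 2) {ξ : Config}
    (hξ : ξ ∈ finiteConfigs) :
    ENNReal.ofReal (expSeries (chainRule n) f t ξ) =
      ENNReal.ofReal (Real.exp (-(jumpRate n ξ * t))) * ENNReal.ofReal (f ξ) +
      ∫⁻ s in Set.Ioc 0 t, ENNReal.ofReal (Real.exp (-(jumpRate n ξ * s))) *
        ∑ i ∈ activeFinset n ξ,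
          ENNReal.ofReal (expSeries (chainRule n) f (t - s) (topple i ξ)) := by
  obtain ⟨hcont, h⟩ := expSeries_chain_eq_integral (n := n) hf ht0 ht hξ
  have hnn : ∀ s ∈ Set.Ioc 0 t, ∀ i, 0 ≤ expSeries (chainRule n) f (t - s) (topple i ξ) :=
    fun s hs i => expSeries_chain_nonneg hf hf0 (by linarith [hs.2]) (by linarith [hs.1])
      (topple_mem_finiteConfigs hξ i)
  have hnn' : ∀ s ∈ Set.Ioc 0 t, 0 ≤ Real.exp (-(jumpRate n ξ * s)) *
      ∑ i ∈ activeFinset n ξ, expSeries (chainRule n) f (t - s) (topple i ξ) :=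
    fun s hs => mul_nonneg (Real.exp_nonneg _) (Finset.sum_nonneg fun i _ => hnn s hs i)
  rw [h, intervalIntegral.integral_of_le ht0, ENNReal.ofReal_add
    (mul_nonneg (Real.exp_nonneg _) (hf0 ξ hξ)) (setIntegral_nonneg measurableSet_Ioc hnn'),
    ENNReal.ofReal_mul (Real.exp_nonneg _), ofReal_integral_eq_lintegral_ofReal]
  · congr 1
    refine setLIntegral_congr_fun measurableSet_Ioc fun s hs => ?_
    rw [ENNReal.ofReal_mul (Real.exp_nonneg _), ENNReal.ofReal_sum_of_nonneg fun i _ => hnn s hs i]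
  · exact (hcont.integrableOn_Icc).mono_set Set.Ioc_subset_Icc_self
  · exact (ae_restrict_iff' measurableSet_Ioc).2 (ae_of_all _ hnn')

/-- The recursion is monotone, and the iterates start from zero, below its fixed point. -/
lemma fellerIter_le (m : ℕ) {t : ℝ} (ht0 : 0 ≤ t) (ht : t < 1 / 2) {ξ : Config}
    (hξ : ξ ∈ finiteConfigs) :
    fellerIter n m t (fun ζ => ENNReal.ofReal (f ζ)) ξ ≤
      ENNReal.ofReal (expSeries (chainRule n) f t ξ) := by
  induction m generalizing t ξ with
  | zero => simp [fellerIter, transIter]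
  | succ m ih =>
    rw [fellerIter_succ n m t _ hξ, ofReal_expSeries_chain_eq hf hf0 ht0 ht hξ]
    refine add_le_add le_rfl (setLIntegral_mono' measurableSet_Ioc fun s hs => ?_)
    gcongr with i _
    exact ih (by linarith [hs.2]) (by linarith [hs.1]) (topple_mem_finiteConfigs hξ i)

/-- The gap to the fixed point obeys the recursion without its source term, so
`integral_errorBound_le` halves it at each step. With the other inequality this identifies the
minimal solution. -/
lemma le_fellerIter_add (m : ℕ) {t : ℝ} (ht0 : 0 ≤ t) (ht : t < 1 / 2) {ξ : Config}
    (hξ : ξ ∈ finiteConfigs) :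
    ENNReal.ofReal (expSeries (chainRule n) f t ξ) ≤
      fellerIter n m t (fun ζ => ENNReal.ofReal (f ζ)) ξ +
        ENNReal.ofReal (errorBound C m t (critBound n ξ)) := by
  have hC : 0 ≤ C := (abs_nonneg _).trans (hf ξ hξ)
  induction m generalizing t ξ with
  | zero =>
    refine le_add_left (ENNReal.ofReal_le_ofReal ?_)
    have := abs_expSeries_chain_le (n := n) hf ht0 ht hξ
    rw [errorBound, pow_zero, div_one, ← one_div]
    exact (abs_le.1 this).2
  | succ m ih =>
    rw [fellerIter_succ n m t _ hξ, ofReal_expSeries_chain_eq hf hf0 ht0 ht hξ, add_assoc]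
    refine add_le_add le_rfl ?_
    have hc : jumpRate n ξ ≤ critBound n ξ + 1 := by
      rw [jumpRate_eq hξ]
      exact_mod_cast card_activeFinset_le hξ n
    have hc0 : 0 ≤ jumpRate n ξ := Nat.cast_nonneg _
    have hcont := continuousOn_exp_mul_errorBound C m ht (critBound n ξ + 1) (jumpRate n ξ)
    have hE : ∀ s ∈ Set.Ioc 0 t, 0 ≤ errorBound C m (t - s) (critBound n ξ + 1) :=
      fun s hs => errorBound_nonneg hC m (by linarith [hs.1]) _
    calc ∫⁻ s in Set.Ioc 0 t, ENNReal.ofReal (Real.exp (-(jumpRate n ξ * s))) *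
          ∑ i ∈ activeFinset n ξ,
            ENNReal.ofReal (expSeries (chainRule n) f (t - s) (topple i ξ))
        ≤ ∫⁻ s in Set.Ioc 0 t, (ENNReal.ofReal (Real.exp (-(jumpRate n ξ * s))) *
          ∑ i ∈ activeFinset n ξ,
            fellerIter n m (t - s) (fun ζ => ENNReal.ofReal (f ζ)) (topple i ξ) +
          ENNReal.ofReal (Real.exp (-(jumpRate n ξ * s)) *
            (jumpRate n ξ * errorBound C m (t - s) (critBound n ξ + 1)))) := by
          refine setLIntegral_mono' measurableSet_Ioc fun s hs => ?_
          rw [ENNReal.ofReal_mul (Real.exp_nonneg _), ← mul_add]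
          gcongr
          have e : ENNReal.ofReal (jumpRate n ξ * errorBound C m (t - s) (critBound n ξ + 1)) =
              ∑ i ∈ activeFinset n ξ,
                ENNReal.ofReal (errorBound C m (t - s) (critBound n ξ + 1)) := by
            rw [← ENNReal.ofReal_sum_of_nonneg fun i _ => hE s hs, Finset.sum_const,
              nsmul_eq_mul, jumpRate_eq hξ]
          rw [e, ← Finset.sum_add_distrib]
          refine Finset.sum_le_sum fun i _ => ?_
          have hs1 : 0 ≤ t - s := by linarith [hs.2]
          have hs2 : t - s < 1 / 2 := by linarith [hs.1]
          refine (ih hs1 hs2 (topple_mem_finiteConfigs hξ i)).trans ?_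
          gcongr
          exact errorBound_mono hC m hs1 hs2 (critBound_topple_le hξ n i)
      _ = _ + ∫⁻ s in Set.Ioc 0 t, ENNReal.ofReal (Real.exp (-(jumpRate n ξ * s)) *
            (jumpRate n ξ * errorBound C m (t - s) (critBound n ξ + 1))) := by
          refine lintegral_add_left ?_ _
          refine Measurable.mul (by fun_prop) (Finset.measurable_fun_sum _ fun i _ => ?_)
          exact Measurable.comp (g := fun r => fellerIter n m r
            (fun ζ => ENNReal.ofReal (f ζ)) (topple i ξ)) (measurable_fellerIter n m _ _)
            (measurable_id.const_sub t)
      _ ≤ _ := by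
          gcongr
          rw [← ofReal_integral_eq_lintegral_ofReal, ← intervalIntegral.integral_of_le ht0]
          · exact ENNReal.ofReal_le_ofReal
              (integral_errorBound_le hC m ht0 ht (critBound n ξ) hc0 hc)
          · exact (hcont.integrableOn_Icc).mono_set Set.Ioc_subset_Icc_self
          · exact (ae_restrict_iff' measurableSet_Ioc).2 (ae_of_all _ fun s hs =>
              mul_nonneg (Real.exp_nonneg _) (mul_nonneg hc0 (hE s hs)))

lemma tendsto_fellerIter {t : ℝ} (ht0 : 0 ≤ t) (ht : t < 1 / 2) {ξ : Config}
    (hξ : ξ ∈ finiteConfigs) :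
    Tendsto (fun m => fellerIter n m t (fun ζ => ENNReal.ofReal (f ζ)) ξ) atTop
      (𝓝 (ENNReal.ofReal (expSeries (chainRule n) f t ξ))) := by
  have h := (ENNReal.tendsto_ofReal (tendsto_errorBound C t (critBound n ξ)))
  rw [ENNReal.ofReal_zero] at h
  have h2 := ENNReal.Tendsto.sub
    (tendsto_const_nhds (x := ENNReal.ofReal (expSeries (chainRule n) f t ξ))) h
    (Or.inl ENNReal.ofReal_ne_top)
  rw [tsub_zero] at h2
  refine tendsto_of_tendsto_of_tendsto_of_le_of_le h2 tendsto_const_nhds ?_ ?_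
  · exact fun m => tsub_le_iff_right.2 (le_fellerIter_add hf hf0 m ht0 ht hξ)
  · exact fun m => fellerIter_le hf hf0 m ht0 ht hξ

lemma tsum_transProb_mul {t : ℝ} (ht0 : 0 ≤ t) (ht : t < 1 / 2) {ξ : Config}
    (hξ : ξ ∈ finiteConfigs) :
    ∑' ζ : finiteConfigs, transProb n t ξ ζ * ENNReal.ofReal (f ζ) =
      ENNReal.ofReal (expSeries (chainRule n) f t ξ) := by
  have hmono : ∀ ζ : finiteConfigs,
      Monotone fun m => transIter n m t ξ ζ * ENNReal.ofReal (f ζ) := fun ζ m m' h =>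
    mul_le_mul_left (transIter_mono n t ξ ζ h) _
  have hmono' : Monotone fun m => fellerIter n m t (fun ζ => ENNReal.ofReal (f ζ)) ξ :=
    fun m m' h => ENNReal.tsum_le_tsum fun ζ => hmono ζ h
  refine tendsto_nhds_unique ?_ (tendsto_fellerIter hf hf0 ht0 ht hξ)
  convert! tendsto_atTop_iSup hmono' using 2
  simp_rw [transProb, ENNReal.iSup_mul, fellerIter, ENNReal.tsum_eq_iSup_sum]
  rw [iSup_comm]
  refine iSup_congr fun s => ?_
  exact ENNReal.finsetSum_iSup_of_monotone hmono

end

/-! ### Conservation of mass and signed functions -/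

lemma activeGenerator_add_const (A : ℤ → Bool → Prop) (f : Config → ℝ) (c : ℝ) :
    activeGenerator A (fun ξ => f ξ + c) = activeGenerator A f := by
  funext ξ
  simp [activeGenerator]

lemma activeGenerator_const (A : ℤ → Bool → Prop) (c : ℝ) :
    activeGenerator A (fun _ => c) = fun _ => 0 := by
  funext ξ
  simp [activeGenerator]

lemma iterate_activeGenerator_const (A : ℤ → Bool → Prop) (c : ℝ) (k : ℕ) :
    (activeGenerator A)^[k + 1] (fun _ => c) = fun _ => 0 := by
  induction k with
  | zero => exact activeGenerator_const A c
  | succ k ih => rw [Function.iterate_succ_apply', ih, activeGenerator_const]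

lemma expSeries_const (A : ℤ → Bool → Prop) (c t : ℝ) (ξ : Config) :
    expSeries A (fun _ => c) t ξ = c := by
  rw [expSeries, tsum_eq_single 0]
  · simp [expTerm]
  · intro k hk
    obtain ⟨k, rfl⟩ := Nat.exists_eq_succ_of_ne_zero hk
    rw [expTerm, Nat.succ_eq_add_one, iterate_activeGenerator_const, mul_zero, zero_div]

/-- No mass is lost by explosion: the generator kills constants, so the series of `1` is `1`. -/
lemma tsum_transProb (n : ℕ) {t : ℝ} (ht0 : 0 ≤ t) (ht : t < 1 / 2) {ξ : Config}
    (hξ : ξ ∈ finiteConfigs) : ∑' ζ : finiteConfigs, transProb n t ξ ζ = 1 := by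
  have h := tsum_transProb_mul (n := n) (f := fun _ => 1) (C := 1) (by simp) (by simp) ht0 ht hξ
  simpa [expSeries_const] using h

lemma hasSum_toReal_transProb (n : ℕ) {t : ℝ} (ht0 : 0 ≤ t) (ht : t < 1 / 2) {ξ : Config}
    (hξ : ξ ∈ finiteConfigs) :
    HasSum (fun ζ : finiteConfigs => (transProb n t ξ ζ).toReal) 1 := by
  have h := tsum_transProb n ht0 ht hξ
  have h1 : ∑' ζ : finiteConfigs, transProb n t ξ ζ ≠ ∞ := by simp [h]
  convert! ENNReal.hasSum_toReal h1 using 1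
  rw [← ENNReal.tsum_toReal_eq (ENNReal.ne_top_of_tsum_ne_top h1), h, ENNReal.toReal_one]

lemma chainSemigroup_add_const {n : ℕ} {f : Config → ℝ} {C : ℝ}
    (hf : ∀ ξ ∈ finiteConfigs, |f ξ| ≤ C) (c : ℝ) {t : ℝ} (ht0 : 0 ≤ t) (ht : t < 1 / 2)
    {ξ : Config} (hξ : ξ ∈ finiteConfigs) :
    chainSemigroup n t (fun ζ => f ζ + c) ξ = chainSemigroup n t f ξ + c := by
  have h1 := hasSum_toReal_transProb n ht0 ht hξ
  have h2 : Summable fun ζ : finiteConfigs => (transProb n t ξ ζ).toReal * f ζ := by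
    refine Summable.of_norm_bounded (h1.summable.mul_right C) fun ζ => ?_
    rw [norm_mul, Real.norm_of_nonneg ENNReal.toReal_nonneg]
    exact mul_le_mul_of_nonneg_left (hf ζ ζ.2) ENNReal.toReal_nonneg
  unfold chainSemigroup
  simp_rw [mul_add]
  rw [h2.tsum_add (h1.summable.mul_right c), tsum_mul_right, h1.tsum_eq, one_mul]

lemma chainSemigroup_eq_of_nonneg {n : ℕ} {f : Config → ℝ} {C : ℝ}
    (hf : ∀ ξ ∈ finiteConfigs, |f ξ| ≤ C) (hf0 : ∀ ξ ∈ finiteConfigs, 0 ≤ f ξ)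
    {t : ℝ} (ht0 : 0 ≤ t) (ht : t < 1 / 2) {ξ : Config} (hξ : ξ ∈ finiteConfigs) :
    chainSemigroup n t f ξ = expSeries (chainRule n) f t ξ := by
  have h := congrArg ENNReal.toReal (tsum_transProb_mul (n := n) hf hf0 ht0 ht hξ)
  have hp := ENNReal.ne_top_of_tsum_ne_top
    (show ∑' ζ : finiteConfigs, transProb n t ξ ζ ≠ ∞ by simp [tsum_transProb n ht0 ht hξ])
  rw [ENNReal.toReal_ofReal (expSeries_chain_nonneg hf hf0 ht0 ht hξ),
    ENNReal.tsum_toReal_eq fun ζ => ENNReal.mul_ne_top (hp ζ) ENNReal.ofReal_ne_top] at h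
  rw [← h, chainSemigroup]
  refine tsum_congr fun ζ => ?_
  rw [ENNReal.toReal_mul, ENNReal.toReal_ofReal (hf0 ζ ζ.2)]

/-- The semigroup of a chain is the exponential of its generator, for small times. -/
theorem chainSemigroup_eq_expSeries {n : ℕ} {f : Config → ℝ} {C : ℝ}
    (hf : ∀ ξ ∈ finiteConfigs, |f ξ| ≤ C) {t : ℝ} (ht0 : 0 ≤ t) (ht : t < 1 / 2)
    {ξ : Config} (hξ : ξ ∈ finiteConfigs) :
    chainSemigroup n t f ξ = expSeries (chainRule n) f t ξ := by
  -- Adding `C` makes the function nonnegative, and both sides of the identity shift by `C`.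
  have hg : ∀ ζ ∈ finiteConfigs, |f ζ + C| ≤ C + |C| := fun ζ hζ =>
    (abs_add_le _ _).trans (add_le_add (hf ζ hζ) le_rfl)
  have hg0 : ∀ ζ ∈ finiteConfigs, 0 ≤ f ζ + C := fun ζ hζ => by
    linarith [(abs_le.1 (hf ζ hζ)).1]
  have h1 := chainSemigroup_eq_of_nonneg (n := n) hg hg0 ht0 ht hξ
  rw [chainSemigroup_add_const hf C ht0 ht hξ] at h1
  have hs : |t| < 1 / 2 := by rwa [abs_of_nonneg ht0]
  have h2 : expSeries (chainRule n) (fun ζ => f ζ + C) t ξ =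
      expSeries (chainRule n) f t ξ + C := by
    unfold expSeries
    rw [(summable_expTerm_chain hg hs hξ).of_abs.tsum_eq_zero_add,
      (summable_expTerm_chain hf hs hξ).of_abs.tsum_eq_zero_add]
    simp only [expTerm, Function.iterate_succ_apply, activeGenerator_add_const]
    simp
    ring
  linarith

/-! ### The exponential series at decent configurations -/

/-- Each interval contains a site. Hence the radius in the theorem is at most `1/2`, where the
chains are under control. -/
lemma one_le_meanGap {η : Config} (hη : η ∈ twoSided) : 1 ≤ meanGap η := by
  refine le_limsup_of_frequently_le (Eventually.frequently ?_) (by isBoundedDefault)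
  filter_upwards [eventually_ge_atTop 1] with n hn
  rw [ENNReal.le_div_iff_mul_le (by left; positivity) (by left; finiteness), one_mul]
  have h := (le_card_window hη n).trans (card_window_le η n)
  calc (2 * (n : ℝ≥0∞)) = ((2 * n : ℕ) : ℝ≥0∞) := by push_cast; rfl
    _ ≤ ((∑ j ∈ Finset.Icc (-(n : ℤ)) (n : ℤ), (gap η j).card : ℕ) : ℝ≥0∞) :=
      Nat.cast_le.2 (by omega)
    _ = _ := by push_cast; rfl

lemma one_le_toReal_meanGap {η : Config} (hη : η ∈ decent) : 1 ≤ (meanGap η).toReal := by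
  have h := ENNReal.toReal_mono hη.2.ne (one_le_meanGap hη.1)
  simpa using h

lemma radius_pos {η : Config} (hη : η ∈ decent) :
    0 < 1 / (4 * Real.exp 1 * (meanGap η).toReal) := by
  have := one_le_toReal_meanGap hη
  positivity

lemma radius_le_half {η : Config} (hη : η ∈ decent) :
    1 / (4 * Real.exp 1 * (meanGap η).toReal) ≤ 1 / 2 := by
  have h1 := one_le_toReal_meanGap hη
  have h2 := Real.add_one_le_exp (1 : ℝ)
  refine one_div_le_one_div_of_le (by norm_num) ?_
  nlinarith

lemma eventually_card_window_le {η : Config} (hη : η ∈ decent) {a : ℝ}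
    (ha : (meanGap η).toReal < a) :
    ∀ᶠ n : ℕ in atTop, ((window n η).card : ℝ) ≤ 2 * n * a := by
  have ha0 : 0 ≤ a := ENNReal.toReal_nonneg.trans ha.le
  have h := eventually_lt_of_limsup_lt ((ENNReal.lt_ofReal_iff_toReal_lt hη.2.ne).2 ha)
  filter_upwards [h, eventually_ge_atTop 1] with n hn hn1
  have hn' := (ENNReal.div_le_iff (by positivity) (by finiteness)).1 hn.le
  have h2 : ((window n η).card : ℝ≥0∞) ≤ ENNReal.ofReal (2 * n * a) := by
    calc ((window n η).card : ℝ≥0∞)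
        ≤ ((∑ j ∈ Finset.Icc (-(n : ℤ)) (n : ℤ), (gap η j).card : ℕ) : ℝ≥0∞) :=
          Nat.cast_le.2 (card_window_le η n)
      _ = ∑ j ∈ Finset.Icc (-(n : ℤ)) (n : ℤ), ((gap η j).card : ℝ≥0∞) := by push_cast; rfl
      _ ≤ _ := hn'
      _ = _ := by
        rw [mul_comm (2 * (n : ℝ)), ENNReal.ofReal_mul ha0, ENNReal.ofReal_mul (by norm_num)]
        simp
  have h3 := ENNReal.toReal_mono ENNReal.ofReal_ne_top h2
  rwa [ENNReal.toReal_ofReal (by positivity), ENNReal.toReal_natCast] at h3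

/-- The estimate that produces the radius: one factor 2 comes from differences, one from the two
sides of the origin, and `e` from `M^k / k! ≤ e^M` with `M = N + k`. -/
lemma summable_window {η : Config} (hη : η ∈ decent) (N : ℕ) {t : ℝ} (ht0 : 0 ≤ t)
    (ht : t < 1 / (4 * Real.exp 1 * (meanGap η).toReal)) :
    Summable fun k : ℕ => t ^ k * (2 * ((window (N + k) η).card : ℝ)) ^ k / (k ! : ℝ) := by
  have ha1 := one_le_toReal_meanGap hη
  -- A limsup gives eventual bounds only strictly above its value; the strict bound on `t` leaves
  -- room.
  obtain ⟨a, ha, ha'⟩ : ∃ a, (meanGap η).toReal < a ∧ 4 * Real.exp 1 * t * a < 1 := by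
    have hc : ContinuousWithinAt (fun a : ℝ => 4 * Real.exp 1 * t * a)
        (Set.Ioi (meanGap η).toReal) (meanGap η).toReal :=
      (by fun_prop : Continuous fun a : ℝ => 4 * Real.exp 1 * t * a).continuousWithinAt
    have h1 : 4 * Real.exp 1 * t * (meanGap η).toReal < 1 := by
      rw [lt_div_iff₀ (by positivity)] at ht
      linarith
    obtain ⟨a, h, h'⟩ := ((hc.eventually (gt_mem_nhds h1)).and self_mem_nhdsWithin).exists
    exact ⟨a, h', h⟩
  have ha0 : 0 ≤ a := by linarith
  have hgeom : Summable fun k : ℕ => Real.exp N * (4 * Real.exp 1 * t * a) ^ k :=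
    (summable_geometric_of_lt_one (by positivity) ha').mul_left _
  refine hgeom.of_norm_bounded_eventually_nat ?_
  have hev := (tendsto_add_atTop_nat N).eventually (eventually_card_window_le hη ha)
  filter_upwards [hev] with k hk
  rw [add_comm k N] at hk
  rw [Real.norm_of_nonneg (by positivity)]
  have h1 := Real.pow_div_factorial_le_exp (x := ((N + k : ℕ) : ℝ)) (by positivity) k
  calc t ^ k * (2 * ((window (N + k) η).card : ℝ)) ^ k / (k ! : ℝ)
      ≤ t ^ k * (2 * (2 * (N + k : ℕ) * a)) ^ k / (k ! : ℝ) := by gcongr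
    _ = (4 * t * a) ^ k * (((N + k : ℕ) : ℝ) ^ k / (k ! : ℝ)) := by
      rw [← mul_div_assoc, ← mul_pow, ← mul_pow]
      ring_nf
    _ ≤ (4 * t * a) ^ k * Real.exp ((N + k : ℕ) : ℝ) := by gcongr
    _ = _ := by
      rw [Nat.cast_add, Real.exp_add, ← Real.exp_one_pow k]
      ring

section

variable {N : ℕ} {f : Config → ℝ} (hf : NLocal N f) {C : ℝ} (hC : ∀ ξ ∈ twoSided, |f ξ| ≤ C)
include hf hC

/-- The majorant depends neither on the rule `A` nor on `ξ ≤ η`, so one series dominates all the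
limits taken below. -/
lemma abs_expTerm_le (A : ℤ → Bool → Prop) {t : ℝ} (ht0 : 0 ≤ t) (k : ℕ) {ξ η : Config}
    (hξ : ξ ∈ twoSided) (hη : η ∈ twoSided) (h : ξ ≤ η) :
    |expTerm A f t ξ k| ≤ C * (t ^ k * (2 * ((window (N + k) η).card : ℝ)) ^ k / (k ! : ℝ)) := by
  have hC0 : 0 ≤ C := (abs_nonneg _).trans (hC ξ hξ)
  rw [expTerm, abs_div, abs_mul, abs_pow, Nat.abs_cast, abs_of_nonneg ht0, ← mul_div_assoc,
    mul_left_comm]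
  have h1 := hf.abs_iterate_le hC A k hξ
  have h2 : ((window (N + k) ξ).card : ℝ) ≤ (window (N + k) η).card :=
    Nat.cast_le.2 (Finset.card_le_card (window_anti hξ hη h _))
  have h3 : |(activeGenerator A)^[k] f ξ| ≤ C * (2 * ((window (N + k) η).card : ℝ)) ^ k :=
    h1.trans (by gcongr)
  gcongr

variable {η : Config} (hη : η ∈ decent) {t : ℝ} (ht0 : 0 ≤ t)
  (ht : t < 1 / (4 * Real.exp 1 * (meanGap η).toReal))
include hη ht0 ht

lemma summable_abs_expTerm (A : ℤ → Bool → Prop) : Summable fun k => |expTerm A f t η k| :=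
  Summable.of_nonneg_of_le (fun _ => abs_nonneg _)
    (fun k => abs_expTerm_le hf hC A ht0 k hη.1 hη.1 le_rfl)
    ((summable_window hη N ht0 ht).mul_left C)

end

/-- The exponential series depends continuously on the activity rule and on the function. -/
lemma tendsto_expSeries {N : ℕ} {f : Config → ℝ} (hf : NLocal N f) {C : ℝ} {η : Config}
    (hη : η ∈ decent) {t : ℝ} (ht0 : 0 ≤ t)
    (ht : t < 1 / (4 * Real.exp 1 * (meanGap η).toReal)) {B : ℕ → ℤ → Bool → Prop} {A : ℤ → Bool → Prop} {g : ℕ → Config → ℝ}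
    (hB : ∀ i b, ∀ᶠ n in atTop, B n i b ↔ A i b) (hg : ∀ n, NLocal N (g n))
    (hgC : ∀ n, ∀ ξ ∈ twoSided, |g n ξ| ≤ C)
    (h : ∀ ξ ∈ twoSided, Tendsto (fun n => g n ξ) atTop (𝓝 (f ξ))) :
    Tendsto (fun n => expSeries (B n) (g n) t η) atTop (𝓝 (expSeries A f t η)) := by
  refine tendsto_tsum_of_dominated_convergence ((summable_window hη N ht0 ht).mul_left C) ?_ ?_
  · intro k
    exact ((tendsto_iterate hB hg hf h k hη.1).const_mul _).div_const _
  · exact Eventually.of_forall fun n k =>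
      abs_expTerm_le (hg n) (hgC n) (B n) ht0 k hη.1 hη.1 le_rfl

theorem hasIteratedLimit_expSeries {N : ℕ} {f : Config → ℝ} (hf : NLocal N f) {C : ℝ}
    (hC : ∀ ξ ∈ twoSided, |f ξ| ≤ C) {η : Config} (hη : η ∈ decent) {t : ℝ} (ht0 : 0 ≤ t)
    (ht : t < 1 / (4 * Real.exp 1 * (meanGap η).toReal)) :
    HasIteratedLimit t f η (expSeries (fun _ _ => True) f t η) := by
  refine ⟨fun n => expSeries (chainRule n) f t η, ?_, ?_⟩
  · intro n ξ hξ hmono htend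
    have hξ' : ∀ m, ξ m ∈ twoSided := fun m => finiteConfigs_subset_twoSided (hξ m)
    -- This is where monotone sequences matter: being below `η` gives domination by the windows of
    -- `η`.
    have hle : ∀ m, ξ m ≤ η := by
      intro m x
      obtain ⟨m', h1, h2⟩ := ((eventually_agree htend (x.natAbs + 1)).and
        (eventually_ge_atTop m)).exists
      rw [h1 x (by omega) (by omega)]
      exact hmono h2 x
    have hsg : ∀ m, chainSemigroup n t f (ξ m) = expSeries (chainRule n) f t (ξ m) := fun m =>
      chainSemigroup_eq_expSeries (fun ζ hζ => hC ζ (finiteConfigs_subset_twoSided hζ)) ht0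
        (ht.trans_le (radius_le_half hη)) (hξ m)
    simp_rw [hsg]
    refine tendsto_tsum_of_dominated_convergence ((summable_window hη N ht0 ht).mul_left C) ?_ ?_
    · intro k
      refine tendsto_const_nhds.congr' ?_
      -- Each term is local around the origin, hence eventually constant along the sequence.
      filter_upwards [(hf.iterate (chainRule n) k).eventually_eq hη.1 hξ' htend] with m hm
      rw [expTerm, expTerm, hm]
    · exact Eventually.of_forall fun m k =>
        abs_expTerm_le hf hC _ ht0 k (hξ' m) hη.1 (hle m)
  · refine tendsto_expSeries hf hη ht0 ht (fun i b => ?_) (fun _ => hf) (fun _ => hC)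
      fun _ _ => tendsto_const_nhds
    filter_upwards [eventually_ge_atTop i.natAbs] with n hn
    simp only [chainRule, iff_true]
    right
    omega

/-! ### Truncation to finite configurations -/

/-- The configuration that agrees with `η` on `[-K, K)` and has height 1 elsewhere. -/
def trunc (K : ℕ) (η : Config) : Config := fun x =>
  if -(K : ℤ) ≤ x ∧ x < K then η x else false

lemma trunc_mem_finiteConfigs (K : ℕ) (η : Config) : trunc K η ∈ finiteConfigs := by
  refine (Set.finite_Ico (-(K : ℤ)) K).subset fun x hx => ?_
  by_contra h
  have hx' : trunc K η x = true := hx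
  rw [trunc, if_neg fun h' => h ⟨h'.1, h'.2⟩] at hx'
  exact Bool.false_ne_true hx'

lemma trunc_mono (η : Config) : Monotone fun K => trunc K η := by
  intro K K' h x
  simp only [trunc]
  split_ifs
  · exact le_rfl
  · omega
  · exact bot_le
  · exact le_rfl

lemma tendsto_trunc (η : Config) : Tendsto (fun K => trunc K η) atTop (𝓝 η) := by
  refine tendsto_pi_nhds.2 fun x => tendsto_const_nhds.congr' ?_
  filter_upwards [eventually_ge_atTop (x.natAbs + 1)] with K hK
  rw [trunc, if_pos (by omega)]

/-- The truncations of `η` are an admissible sequence, so the condition on sequences is never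
vacuous. -/
lemma HasIteratedLimit.unique {t : ℝ} {f : Config → ℝ} {η : Config} {v v' : ℝ}
    (h : HasIteratedLimit t f η v) (h' : HasIteratedLimit t f η v') : v = v' := by
  obtain ⟨w, hw, hv⟩ := h
  obtain ⟨w', hw', hv'⟩ := h'
  have e : w = w' := funext fun n => tendsto_nhds_unique
    (hw n _ (fun m => trunc_mem_finiteConfigs m η) (trunc_mono η) (tendsto_trunc η))
    (hw' n _ (fun m => trunc_mem_finiteConfigs m η) (trunc_mono η) (tendsto_trunc η))
  exact tendsto_nhds_unique hv (e ▸ hv')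

/-! ### Local functions -/

section

variable {g : Config → ℝ} {A : Finset ℤ} (hg : DependsOn g (A : Set ℤ))
include hg

lemma continuous_of_dependsOn : Continuous g := by
  obtain ⟨h, rfl⟩ := dependsOn_iff_exists_comp.1 hg
  exact continuous_of_discreteTopology.comp (by fun_prop)

lemma exists_bound_of_dependsOn : ∃ C, ∀ ζ, |g ζ| ≤ C := by
  have hc := (continuous_of_dependsOn hg).abs
  obtain ⟨C, hC⟩ := (isCompact_range hc).bddAbove
  exact ⟨C, fun ζ => hC ⟨ζ, rfl⟩⟩

/-- At most `|x|` ones separate `x` from the origin, so every window of index at least `|x|`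
contains `x`. -/
lemma exists_nLocal_of_dependsOn : ∃ N, NLocal N g := by
  refine ⟨A.sup Int.natAbs, fun ξ hξ ξ' hξ' _ h => hg fun x hx => h x ?_⟩
  rw [mem_window_iff hξ]
  exact (oneCount_le_natAbs ξ x).trans (Finset.le_sup (f := Int.natAbs) hx)

end

/-! ### Existence of the law -/

/-- The law of the `n`-th chain at time `t`. -/
def chainLaw (n : ℕ) (t : ℝ) (ξ : Config) : Measure Config :=
  Measure.sum fun ζ : finiteConfigs => transProb n t ξ ζ • Measure.dirac (ζ : Config)

lemma isProbabilityMeasure_chainLaw (n : ℕ) {t : ℝ} (ht0 : 0 ≤ t) (ht : t < 1 / 2) {ξ : Config}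
    (hξ : ξ ∈ finiteConfigs) : IsProbabilityMeasure (chainLaw n t ξ) := by
  constructor
  rw [chainLaw, Measure.sum_apply _ MeasurableSet.univ]
  simpa using tsum_transProb n ht0 ht hξ

lemma integral_chainLaw (n : ℕ) {t : ℝ} (ht0 : 0 ≤ t) (ht : t < 1 / 2) {ξ : Config}
    (hξ : ξ ∈ finiteConfigs) {g : Config → ℝ} (hg : Continuous g) {C : ℝ}
    (hC : ∀ ζ, |g ζ| ≤ C) : ∫ ζ, g ζ ∂(chainLaw n t ξ) = chainSemigroup n t g ξ := by
  have := isProbabilityMeasure_chainLaw n ht0 ht hξ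
  have hint : Integrable g (chainLaw n t ξ) :=
    Integrable.of_bound hg.aestronglyMeasurable C (ae_of_all _ hC)
  rw [chainLaw] at hint ⊢
  rw [integral_sum_measure hint, chainSemigroup]
  refine tsum_congr fun ζ => ?_
  rw [integral_smul_measure, integral_dirac, smul_eq_mul]

/-- Limits of the chain laws along an ultrafilter exist by compactness, in `m` and then in `n`.
Local functions are continuous, so their integrals follow, and these agree with the iterated limits
already known to exist. -/
theorem exists_isSandpileLaw {η : Config} (hη : η ∈ decent) {t : ℝ} (ht0 : 0 ≤ t)
    (ht : t < 1 / (4 * Real.exp 1 * (meanGap η).toReal)) : ∃ P, IsSandpileLaw t η P := by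
  have ht2 := ht.trans_le (radius_le_half hη)
  let μ : ℕ → ℕ → ProbabilityMeasure Config := fun n m =>
    ⟨chainLaw n t (trunc m η), isProbabilityMeasure_chainLaw n ht0 ht2
      (trunc_mem_finiteConfigs m η)⟩
  have hlim : ∀ ν : ℕ → ProbabilityMeasure Config, ∃ P : ProbabilityMeasure Config,
      Tendsto ν (hyperfilter ℕ) (𝓝 P) := by
    intro ν
    obtain ⟨P, -, hP⟩ := isCompact_univ.ultrafilter_le_nhds ((hyperfilter ℕ).map ν) (by simp)
    exact ⟨P, hP⟩
  choose Q hQ using fun n => hlim (μ n)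
  obtain ⟨P, hP⟩ := hlim Q
  refine ⟨P, inferInstance, fun A g hg => ?_⟩
  obtain ⟨N, hN⟩ := exists_nLocal_of_dependsOn hg
  obtain ⟨C, hC⟩ := exists_bound_of_dependsOn hg
  have hcont := continuous_of_dependsOn hg
  have hit := hasIteratedLimit_expSeries hN (fun ξ _ => hC ξ) hη ht0 ht
  obtain ⟨w, hw, hv⟩ := hit
  refine ⟨w, hw, ?_⟩
  let G : BoundedContinuousFunction Config ℝ := BoundedContinuousFunction.ofNormedAddCommGroup
    g hcont C hC
  have hQw : ∀ n, ∫ ζ, g ζ ∂(Q n : Measure Config) = w n := by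
    intro n
    have h1 := ProbabilityMeasure.tendsto_iff_forall_integral_tendsto.1 (hQ n) G
    have h2 := (hw n _ (fun m => trunc_mem_finiteConfigs m η) (trunc_mono η)
      (tendsto_trunc η)).mono_left Nat.hyperfilter_le_atTop
    refine tendsto_nhds_unique h1 (h2.congr fun m => ?_)
    exact (integral_chainLaw n ht0 ht2 (trunc_mem_finiteConfigs m η) hcont hC).symm
  have h1 := ProbabilityMeasure.tendsto_iff_forall_integral_tendsto.1 hP G
  have h2 : ∫ ζ, g ζ ∂(P : Measure Config) = expSeries (fun _ _ => True) g t η :=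
    tendsto_nhds_unique h1 ((hv.mono_left Nat.hyperfilter_le_atTop).congr fun n => (hQw n).symm)
  rwa [h2]

/-! ### Local approximation of `N`-local functions -/

/-- There are more than `N` ones both in `[-K, 0)` and in `[0, K)`. -/
def ManyOnes (N K : ℕ) (ζ : Config) : Prop := N < oneCount ζ K ∧ N < oneCount ζ (-(K : ℤ))

lemma manyOnes_congr {N K : ℕ} {ζ ζ' : Config} (h : ∀ x : ℤ, -(K : ℤ) ≤ x → x < K → ζ x = ζ' x) :
    ManyOnes N K ζ ↔ ManyOnes N K ζ' := by
  unfold ManyOnes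
  rw [oneCount_congr (ξ := ζ) (ξ' := ζ') (x := K) fun y hy hy' => h y (by omega) (by omega),
    oneCount_congr (ξ := ζ) (ξ' := ζ') (x := -K) fun y hy hy' => h y (by omega) (by omega)]

open Classical in
/-- The local function that agrees with an `N`-local function `f` where `[-K, K)` has more than
`N` ones on each side. -/
def cutoff (N K : ℕ) (f : Config → ℝ) (ζ : Config) : ℝ :=
  if ManyOnes N K ζ then f (trunc K ζ) else 0

lemma trunc_apply {K : ℕ} {ζ : Config} {x : ℤ} (h : -(K : ℤ) ≤ x) (h' : x < K) :
    trunc K ζ x = ζ x := if_pos ⟨h, h'⟩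

lemma dependsOn_cutoff (N K : ℕ) (f : Config → ℝ) :
    DependsOn (cutoff N K f) (Finset.Ico (-(K : ℤ)) K : Finset ℤ) := by
  intro ζ ζ' h
  have h' : ∀ x : ℤ, -(K : ℤ) ≤ x → x < K → ζ x = ζ' x := fun x hx hx' =>
    h x (Finset.mem_coe.2 (Finset.mem_Ico.2 ⟨hx, hx'⟩))
  have e : trunc K ζ = trunc K ζ' := by
    funext x
    simp only [trunc]
    split_ifs with hx
    · exact h' x hx.1 hx.2
    · rfl
  have hm : ManyOnes N K ζ ↔ ManyOnes N K ζ' := manyOnes_congr h'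
  by_cases hm' : ManyOnes N K ζ
  · rw [cutoff, if_pos hm', cutoff, if_pos (hm.1 hm'), e]
  · rw [cutoff, if_neg hm', cutoff, if_neg (mt hm.2 hm')]

lemma abs_cutoff_le (N K : ℕ) {f : Config → ℝ} {C : ℝ} (hC : ∀ ξ ∈ twoSided, |f ξ| ≤ C)
    (ζ : Config) : |cutoff N K f ζ| ≤ C := by
  have h := hC _ (finiteConfigs_subset_twoSided (trunc_mem_finiteConfigs K ζ))
  unfold cutoff
  split_ifs
  · exact h
  · rw [abs_zero]
    exact (abs_nonneg _).trans h

section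

variable {N : ℕ} {f : Config → ℝ} (hf : NLocal N f)
include hf

lemma cutoff_eq {K : ℕ} {ζ : Config} (hζ : ζ ∈ twoSided) (h : ManyOnes N K ζ) :
    cutoff N K f ζ = f ζ := by
  rw [cutoff, if_pos h]
  have ht := finiteConfigs_subset_twoSided (trunc_mem_finiteConfigs K ζ)
  obtain ⟨h1, h2⟩ := window_eq_of_agree hζ ht (fun x hx hx' => (trunc_apply hx hx').symm) h.1 h.2
  exact (hf _ hζ _ ht h1 h2).symm

/-- `ManyOnes N K` says that neither `K` nor `-K` is in the `N`-window, so the cutoff uses no more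
of the configuration than `f` does. The index `N` does not grow with `K`, as `tendsto_expSeries`
requires. -/
lemma nLocal_cutoff (K : ℕ) : NLocal N (cutoff N K f) := by
  intro ζ hζ ζ' hζ' hwin h
  have e : ManyOnes N K ζ ↔ ManyOnes N K ζ' := by
    unfold ManyOnes
    simp only [← not_le]
    rw [← mem_window_iff hζ, ← mem_window_iff hζ, hwin, mem_window_iff hζ', mem_window_iff hζ']
  by_cases hm : ManyOnes N K ζ
  · rw [cutoff_eq hf hζ hm, cutoff_eq hf hζ' (e.1 hm)]
    exact hf _ hζ _ hζ' hwin h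
  · rw [cutoff, if_neg hm, cutoff, if_neg (mt e.2 hm)]

lemma tendsto_cutoff {ζ : Config} (hζ : ζ ∈ twoSided) :
    Tendsto (fun K => cutoff N K f ζ) atTop (𝓝 (f ζ)) := by
  refine tendsto_const_nhds.congr' ?_
  filter_upwards [eventually_lt_oneCount hζ N] with K hK
  exact (cutoff_eq hf hζ hK).symm

end

lemma mem_twoSided_of_forall_manyOnes {ζ : Config} (h : ∀ N, ∃ K, ManyOnes N K ζ) :
    ζ ∈ twoSided := by
  constructor
  · intro hfin
    obtain ⟨K, -, hK⟩ := h hfin.toFinset.card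
    refine hK.not_ge (Finset.card_le_card fun x hx => ?_)
    rw [Finset.mem_filter, Finset.mem_Ico] at hx
    exact hfin.mem_toFinset.2 ⟨by omega, hx.2⟩
  · intro hfin
    -- The extra 1 allows for the origin, counted in `[0, K)` but not among the positive sites.
    obtain ⟨K, hK, -⟩ := h (hfin.toFinset.card + 1)
    refine hK.not_ge ((Finset.card_le_card fun x hx => ?_).trans (Finset.card_insert_le 0 _))
    rw [Finset.mem_filter, Finset.mem_Ico] at hx
    rw [Finset.mem_insert, hfin.mem_toFinset]
    by_cases h0 : x = 0
    · exact Or.inl h0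
    · exact Or.inr ⟨by omega, hx.2⟩

/-! ### Integrals with respect to the law -/

section

variable {η : Config} (hη : η ∈ decent) {t : ℝ} (ht0 : 0 ≤ t)
  (ht : t < 1 / (4 * Real.exp 1 * (meanGap η).toReal)) {P : Measure Config}
  (hP : IsSandpileLaw t η P)
include hη ht0 ht hP

lemma tendsto_integral_cutoff {N : ℕ} {f : Config → ℝ} (hf : NLocal N f) {C : ℝ}
    (hC : ∀ ξ ∈ twoSided, |f ξ| ≤ C) :
    Tendsto (fun K => ∫ ζ, cutoff N K f ζ ∂P) atTop (𝓝 (expSeries (fun _ _ => True) f t η)) := by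
  have h : ∀ K, ∫ ζ, cutoff N K f ζ ∂P = expSeries (fun _ _ => True) (cutoff N K f) t η :=
    fun K => (hP.2 _ _ (dependsOn_cutoff N K f)).unique (hasIteratedLimit_expSeries
      (nLocal_cutoff hf K) (fun ζ _ => abs_cutoff_le N K hC ζ) hη ht0 ht)
  simp_rw [h]
  exact tendsto_expSeries hf hη ht0 ht (fun _ _ => Eventually.of_forall fun _ => Iff.rfl)
    (fun K => nLocal_cutoff hf K) (fun K ζ _ => abs_cutoff_le N K hC ζ)
    fun ζ hζ => tendsto_cutoff hf hζ

/-- The cutoffs of the constant `1` are the indicators of `ManyOnes N K`. Their integrals tend to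
the series of `1`, which is `1`, so for each `N` almost surely some `K` works. -/
lemma ae_mem_twoSided : ∀ᵐ ζ ∂P, ζ ∈ twoSided := by
  have := hP.1
  have h : ∀ N : ℕ, ∀ᵐ ζ ∂P, ∃ K, ManyOnes N K ζ := by
    intro N
    have hmeas : ∀ K, MeasurableSet {ζ | ManyOnes N K ζ} := by
      intro K
      have hc := (continuous_of_dependsOn (dependsOn_cutoff N K fun _ => 1)).measurable
      convert! hc (measurableSet_singleton 1) using 1
      ext ζ
      by_cases hm : ManyOnes N K ζ <;> simp [cutoff, hm]
    have hint : ∀ K, ∫ ζ, cutoff N K (fun _ => 1) ζ ∂P = P.real {ζ | ManyOnes N K ζ} := by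
      intro K
      rw [← integral_indicator_one (hmeas K)]
      refine integral_congr_ae (ae_of_all _ fun ζ => ?_)
      by_cases hm : ManyOnes N K ζ <;> simp [cutoff, hm]
    have hlim := tendsto_integral_cutoff hη ht0 ht hP (N := N) (f := fun _ => 1) (C := 1)
      (fun _ _ _ _ _ _ => rfl) (by simp)
    rw [expSeries_const] at hlim
    simp_rw [hint] at hlim
    have hU : MeasurableSet {ζ | ∃ K, ManyOnes N K ζ} := by
      have e : {ζ | ∃ K, ManyOnes N K ζ} = ⋃ K, {ζ | ManyOnes N K ζ} := by
        ext ζ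
        simp
      rw [e]
      exact MeasurableSet.iUnion hmeas
    have h1 : 1 ≤ P.real {ζ | ∃ K, ManyOnes N K ζ} :=
      le_of_tendsto' hlim fun K => measureReal_mono fun ζ hζ => ⟨K, hζ⟩
    refine (mem_ae_iff_prob_eq_one hU).2 ?_
    refine le_antisymm prob_le_one ?_
    have h2 := ENNReal.ofReal_le_ofReal h1
    rwa [ENNReal.ofReal_one, ofReal_measureReal] at h2
  filter_upwards [ae_all_iff.2 h] with ζ hζ
  exact mem_twoSided_of_forall_manyOnes hζ

/-- Measurability of `f` is not assumed, and its values off `twoSided` are arbitrary; it is almost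
everywhere the limit of its continuous, uniformly bounded cutoffs. -/
lemma integrable_and_integral_eq {N : ℕ} {f : Config → ℝ} (hf : NLocal N f) {C : ℝ}
    (hC : ∀ ξ ∈ twoSided, |f ξ| ≤ C) :
    Integrable f P ∧ ∫ ζ, f ζ ∂P = expSeries (fun _ _ => True) f t η := by
  have := hP.1
  have hae := ae_mem_twoSided hη ht0 ht hP
  have hlim : ∀ᵐ ζ ∂P, Tendsto (fun K => cutoff N K f ζ) atTop (𝓝 (f ζ)) := by
    filter_upwards [hae] with ζ hζ
    exact tendsto_cutoff hf hζ
  have hcut : ∀ K, AEStronglyMeasurable (cutoff N K f) P := fun K =>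
    (continuous_of_dependsOn (dependsOn_cutoff N K f)).aestronglyMeasurable
  have hmeas : AEStronglyMeasurable f P := aestronglyMeasurable_of_tendsto_ae atTop hcut hlim
  refine ⟨Integrable.of_bound hmeas C (hae.mono hC), ?_⟩
  refine tendsto_nhds_unique ?_ (tendsto_integral_cutoff hη ht0 ht hP hf hC)
  exact tendsto_integral_of_dominated_convergence (fun _ => C) hcut (integrable_const C)
    (fun K => ae_of_all _ fun ζ => abs_cutoff_le N K hC ζ) hlim

end

lemma isSandpileLaw_sandpileLaw {η : Config} (hη : η ∈ decent) {t : ℝ} (ht0 : 0 ≤ t)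
    (ht : t < 1 / (4 * Real.exp 1 * (meanGap η).toReal)) :
    IsSandpileLaw t η (sandpileLaw t η) := by
  have h := exists_isSandpileLaw hη ht0 ht
  rw [sandpileLaw, dif_pos h]
  exact h.choose_spec

/-! ### Convergence of the generator series and the derivative at time zero -/

lemma NLocal.summable_generator {M : ℕ} {g : Config → ℝ} (hg : NLocal M g) {ξ : Config}
    (hξ : ξ ∈ twoSided) : Summable fun i : ℤ => g (topple i ξ) - g ξ :=
  (hasSum_sum_of_ne_finset_zero (s := window (M + 1) ξ) fun i hi => by
    rw [hg.apply_topple hξ hi, sub_self]).summable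

/-- The derivative at zero from the right of a power series. -/
lemma tendsto_div_of_hasSum {a : ℕ → ℝ} {S : ℝ → ℝ} {r : ℝ} (hr : 0 < r)
    (hsum : ∀ t, 0 ≤ t → t < r → Summable fun k => |t ^ k * a k|)
    (hS : ∀ t, 0 ≤ t → t < r → HasSum (fun k => t ^ k * a k) (S t)) :
    Tendsto (fun t => (S t - a 0) / t) (𝓝[>] 0) (𝓝 (a 1)) := by
  have hr2 : 0 < r / 2 := by positivity
  -- The shifted series at `r / 2` dominates the difference quotients for all smaller positive
  -- times.
  have hbound : Summable fun k => (r / 2) ^ k * |a (k + 1)| := by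
    have h := ((summable_nat_add_iff 1).2 (hsum (r / 2) hr2.le (by linarith))).mul_left (r / 2)⁻¹
    refine h.congr fun k => ?_
    rw [abs_mul, abs_of_nonneg (by positivity), pow_succ]
    field_simp
  have hlim : Tendsto (fun t : ℝ => ∑' k, t ^ k * a (k + 1)) (𝓝[>] 0)
      (𝓝 (∑' k, (0 : ℝ) ^ k * a (k + 1))) := by
    refine tendsto_tsum_of_dominated_convergence hbound (fun k => ?_) ?_
    · exact (((continuous_pow k).tendsto 0).mono_left nhdsWithin_le_nhds).mul_const _
    · filter_upwards [Ioo_mem_nhdsGT hr2] with t ht k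
      rw [norm_mul, Real.norm_eq_abs, Real.norm_eq_abs, abs_pow, abs_of_pos ht.1]
      gcongr
      exacts [ht.1.le, ht.2.le]
  have h0 : ∑' k, (0 : ℝ) ^ k * a (k + 1) = a 1 := by
    rw [tsum_eq_single 0 fun k hk => by simp [hk]]
    simp
  rw [h0] at hlim
  refine hlim.congr' ?_
  filter_upwards [Ioo_mem_nhdsGT hr] with t ht
  rw [← (hS t ht.1.le ht.2).tsum_eq, (hS t ht.1.le ht.2).summable.tsum_eq_zero_add, pow_zero,
    one_mul, add_sub_cancel_left, eq_div_iff ht.1.ne', mul_comm, ← tsum_mul_left]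
  refine tsum_congr fun k => ?_
  ring

end Sandpile

end

theorem theorem4p1 (N : ℕ) (f : Sandpile.Config → ℝ) (hf : Sandpile.NLocal N f)
    (hbdd : ∃ C : ℝ, ∀ ξ ∈ Sandpile.twoSided, |f ξ| ≤ C)
    (η : Sandpile.Config) (hη : η ∈ Sandpile.decent) :
    (∀ n : ℕ, ∀ ξ ∈ Sandpile.twoSided, Summable fun i : ℤ =>
      Sandpile.generator^[n] f (Sandpile.topple i ξ) - Sandpile.generator^[n] f ξ) ∧
    (∀ t : ℝ, 0 ≤ t → t < 1 / (4 * Real.exp 1 * (Sandpile.meanGap η).toReal) →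
      Sandpile.IsSandpileLaw t η (Sandpile.sandpileLaw t η) ∧
      (∀ᵐ ζ ∂(Sandpile.sandpileLaw t η), ζ ∈ Sandpile.twoSided) ∧
      Integrable f (Sandpile.sandpileLaw t η) ∧
      Summable (fun n : ℕ => |t ^ n * Sandpile.generator^[n] f η / (n ! : ℝ)|) ∧
      HasSum (fun n : ℕ => t ^ n * Sandpile.generator^[n] f η / (n ! : ℝ))
        (Sandpile.semigroup t f η) ∧
      Sandpile.HasIteratedLimit t f η (Sandpile.semigroup t f η)) ∧
    Tendsto (fun t : ℝ => (Sandpile.semigroup t f η - f η) / t) (𝓝[>] 0)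
      (𝓝 (Sandpile.generator f η)) := by
  obtain ⟨C, hC⟩ := hbdd
  have hmain : ∀ t : ℝ, 0 ≤ t → t < 1 / (4 * Real.exp 1 * (Sandpile.meanGap η).toReal) →
      Sandpile.IsSandpileLaw t η (Sandpile.sandpileLaw t η) ∧
      (∀ᵐ ζ ∂(Sandpile.sandpileLaw t η), ζ ∈ Sandpile.twoSided) ∧
      Integrable f (Sandpile.sandpileLaw t η) ∧
      Summable (fun n : ℕ => |t ^ n * Sandpile.generator^[n] f η / (n ! : ℝ)|) ∧
      HasSum (fun n : ℕ => t ^ n * Sandpile.generator^[n] f η / (n ! : ℝ))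
        (Sandpile.semigroup t f η) ∧
      Sandpile.HasIteratedLimit t f η (Sandpile.semigroup t f η) := by
    intro t ht0 ht
    have hP := Sandpile.isSandpileLaw_sandpileLaw hη ht0 ht
    obtain ⟨hint, heq⟩ := Sandpile.integrable_and_integral_eq hη ht0 ht hP hf hC
    have hsum := Sandpile.summable_abs_expTerm hf hC hη ht0 ht fun _ _ => True
    have hval : Sandpile.semigroup t f η = Sandpile.expSeries (fun _ _ => True) f t η := heq
    have hHas : HasSum (Sandpile.expTerm (fun _ _ => True) f t η)
        (Sandpile.semigroup t f η) := hval ▸ hsum.of_abs.hasSum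
    unfold Sandpile.expTerm at hsum hHas
    rw [Sandpile.activeGenerator_true] at hsum hHas
    refine ⟨hP, Sandpile.ae_mem_twoSided hη ht0 ht hP, hint, hsum, hHas, ?_⟩
    rw [hval]
    exact Sandpile.hasIteratedLimit_expSeries hf hC hη ht0 ht
  refine ⟨fun n ξ hξ => ?_, hmain, ?_⟩
  · have hloc := hf.iterate (fun _ _ => True) n
    rw [Sandpile.activeGenerator_true] at hloc
    exact hloc.summable_generator hξ
  · have h := Sandpile.tendsto_div_of_hasSum
      (a := fun k => Sandpile.generator^[k] f η / (k ! : ℝ)) (Sandpile.radius_pos hη)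
      (fun t ht0 ht => by simpa only [mul_div_assoc] using (hmain t ht0 ht).2.2.2.1)
      (fun t ht0 ht => by simpa only [mul_div_assoc] using (hmain t ht0 ht).2.2.2.2.1)
    simpa using h
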